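/- Let $M$ be a (connected) Riemann surface with complex structure $J$ on $TM$, and for a smooth map $g$ from $M$ to a real vector space write $*dg=dg\circ J$. Identify $\mathbb R^4$ with the quaternions $\mathbb H$. Let $f:M\to\mathbb H$ be a smooth conformal immersion, i.e. an immersion for which there are $N,R:M\to\mathbb H$ (then unique, called the left and right normal vector of $f$) with $N^2=-1=R^2$ and $*df=N\,df=-df\,R$. Let $II(X,Y)=(X\cdot df(Y))^{\perp}$ be its second fundamental form. Call $f$ super-conformal if at every $p\in M$ the curvature ellipse $\{II(X,X): X\in T_pM,\ |df(X)|=1\}$ is a circle in the normal plane $df(T_pM)^\perp$, a single point (at umbilic points) being regarded as a circle of radius $0$. Regard $\mathbb H^2$ as a right quaternionic vector space, let $\mathbb HP^1$ be the set of its quaternionic lines, and identify $\mathbb H^2=\mathbb C^4$, where $i$ acts by right multiplication. A holomorphic curve in $\mathbb CP^3$ is a smooth complex line subbundle $E\subset M\times\mathbb C^4$ such that $*\delta_E=\delta_E J_E$, where $J_E$ is multiplication by $i$ on $E$ and $\delta_E(X)\varphi=d\varphi(X)\bmod E$ for smooth local sections $\varphi$ of $E$. A map $g:M\to\mathbb HP^1$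 is the twistor projection of $E$ if $g(p)=E_p\mathbb H$ for all $p\in M$. Then the following are equivalent: (i) $f$ is super-conformal; (ii) $\begin{bmatrix} f\\1\end{bmatrix}:M\to\mathbb HP^1$ or $\begin{bmatrix}\bar f\\1\end{bmatrix}:M\to\mathbb HP^1$ is the twistor projection of a holomorphic curve in $\mathbb CP^3$; (iii) the right normal vector $R$ of $f$, or the right normal vector $R$ of $\bar f$, satisfies $*dR=R\,dR$ on all of $M$. -/

import Mathlib

open scoped Manifold ContDiff Quaternion

namespace SuperConformal

noncomputable section

/-! Throughout, `M` is a Riemann surface: a charted space over `ℂ` with holomorphic transition maps.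
Its tangent space at `p` is, by definition in Mathlib, a copy of `ℂ` (through the preferred chart
at `p`); as the transition maps are holomorphic, multiplication by `Complex.I` on this copy
is the complex structure `J : T_pM → T_pM`.  Real smoothness is smoothness with respect to the
real model `𝓘(ℝ, ℂ)`. -/

section Surface

variable {M : Type*} [TopologicalSpace M] [ChartedSpace ℂ M]

/-- The real differential `d_p g : T_pM → F` of a map from the surface to a real normed space. -/
def diff {F : Type*} [NormedAddCommGroup F] [NormedSpace ℝ F] (g : M → F) (p : M) : ℂ →L[ℝ] F :=
  mfderiv 𝓘(ℝ, ℂ) 𝓘(ℝ, F) g p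

/-- The form `*dg = dg ∘ J`. -/
def starDiff {F : Type*} [NormedAddCommGroup F] [NormedSpace ℝ F] (g : M → F) (p : M) (X : ℂ) : F :=
  diff g p (Complex.I * X)

/-- `N` is a left normal vector of `f`: `N² = -1` and `*df = N df`. -/
def IsLeftNormal (f N : M → ℍ[ℝ]) : Prop :=
  (∀ p, N p * N p = -1) ∧ ∀ p X, starDiff f p X = N p * diff f p X

/-- `R` is a right normal vector of `f`: `R² = -1` and `*df = -df R`. -/
def IsRightNormal (f R : M → ℍ[ℝ]) : Prop :=
  (∀ p, R p * R p = -1) ∧ ∀ p X, starDiff f p X = -(diff f p X * R p)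

/-- A smooth conformal immersion of the surface into `ℍ = ℝ⁴`. -/
structure IsConformalImmersion (f : M → ℍ[ℝ]) : Prop where
  smooth : ContMDiff 𝓘(ℝ, ℂ) 𝓘(ℝ, ℍ[ℝ]) ∞ f
  immersion : ∀ p, Function.Injective (diff f p)
  conformal : ∃ N R : M → ℍ[ℝ], IsLeftNormal f N ∧ IsRightNormal f R

/-- The Euclidean normal space of `f` at `p`, the orthogonal complement of `df(T_pM)`. -/
def normalSpace (f : M → ℍ[ℝ]) (p : M) : Submodule ℝ ℍ[ℝ] :=
  (LinearMap.range (diff f p).toLinearMap)ᗮ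

/-- The second fundamental form `II(X, Y) = (X · df(Y))^⊥` at `p`, where `Y` is extended to the
vector field with constant coefficients in the preferred chart at `p` (the normal part does not
depend on the extension). -/
def secondFundamentalForm (f : M → ℍ[ℝ]) (p : M) (X Y : ℂ) : ℍ[ℝ] :=
  (normalSpace f p).starProjection
    (fderiv ℝ (fun z => fderiv ℝ (f ∘ (chartAt ℂ p).symm) z Y) (chartAt ℂ p p) X)

/-- The curvature ellipse at `p`: the image of the unit tangential circle under the quadratic
second fundamental form. -/
def curvatureEllipse (f : M → ℍ[ℝ]) (p : M) : Set ℍ[ℝ] :=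
  {v | ∃ X : ℂ, ‖diff f p X‖ = 1 ∧ v = secondFundamentalForm f p X X}

/-- `f` is super-conformal: at every point the curvature ellipse is a circle in the normal plane.
The radius may be `0` (umbilic points). -/
def IsSuperConformal (f : M → ℍ[ℝ]) : Prop :=
  ∀ p, ∃ c ∈ normalSpace f p, ∃ r : ℝ, 0 ≤ r ∧
    curvatureEllipse f p = {v | v ∈ normalSpace f p ∧ ‖v - c‖ = r}

/-- `*dR = R dR` for the right normal vector `R` of `f`. -/
def RightNormalHolomorphic (f : M → ℍ[ℝ]) : Prop :=
  ∃ R : M → ℍ[ℝ], IsRightNormal f R ∧ ∀ p X, starDiff R p X = R p * diff R p X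

end Surface

/-- Complex projective space `ℂP³`. -/
abbrev CP3 := Projectivization ℂ (Fin 4 → ℂ)

/-- The quaternionic projective line: lines in the *right* `ℍ`-vector space `ℍ²`
(right multiplication by `ℍ` is the module structure over the opposite ring). -/
abbrev HP1 := Projectivization (ℍ[ℝ])ᵐᵒᵖ (ℍ[ℝ] × ℍ[ℝ])

/-- The unit `j`. -/
def quatJ : ℍ[ℝ] := ⟨0, 0, 1, 0⟩

/-- The identification `ℂ⁴ = ℍ²`, `(z₀, z₁, z₂, z₃) ↦ (z₀ + j z₁, z₂ + j z₃)`. -/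
def toH2 (z : Fin 4 → ℂ) : ℍ[ℝ] × ℍ[ℝ] :=
  ((z 0 : ℍ[ℝ]) + quatJ * (z 1 : ℍ[ℝ]), (z 2 : ℍ[ℝ]) + quatJ * (z 3 : ℍ[ℝ]))

/-- Under `ℂ⁴ = ℍ²` the complex scalars act by right multiplication. -/
theorem toH2_smul (c : ℂ) (z : Fin 4 → ℂ) :
    toH2 (c • z) = MulOpposite.op (c : ℍ[ℝ]) • toH2 z := by
  simp only [toH2, Pi.smul_apply, smul_eq_mul, Prod.smul_mk, MulOpposite.smul_eq_mul_unop,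
    MulOpposite.unop_op, Quaternion.coeComplex_mul, add_mul, mul_assoc]
  simp only [← Quaternion.coeComplex_mul, mul_comm c]

/-- The affine point `[x; 1]` of `ℍP¹`. -/
def affinePoint (x : ℍ[ℝ]) : HP1 :=
  Projectivization.mk (ℍ[ℝ])ᵐᵒᵖ (x, 1) (fun h => one_ne_zero (congrArg Prod.snd h))

section Twistor

variable {M : Type*} [TopologicalSpace M] [ChartedSpace ℂ M]

/-- `φ` is a smooth section over `U` of the family of complex lines `E ⊂ M × ℂ⁴`. -/
def IsSection (E : M → CP3) (U : Set M) (φ : M → Fin 4 → ℂ) : Prop :=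
  ContMDiffOn 𝓘(ℝ, ℂ) 𝓘(ℝ, Fin 4 → ℂ) ∞ φ U ∧ ∀ q ∈ U, φ q ∈ (E q).submodule

/-- `E` is a smooth complex line subbundle of `M × ℂ⁴`: it has smooth local frames. -/
def IsLineSubbundle (E : M → CP3) : Prop :=
  ∀ p, ∃ U : Set M, IsOpen U ∧ p ∈ U ∧ ∃ φ, IsSection E U φ ∧ ∀ q ∈ U, φ q ≠ 0

/-- `δ_E(X) φ = π_E (dφ(X))`, with values in `ℂ⁴ / E_p`. -/
def delta (E : M → CP3) (φ : M → Fin 4 → ℂ) (p : M) (X : ℂ) :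
    (Fin 4 → ℂ) ⧸ (E p).submodule :=
  (E p).submodule.mkQ (diff φ p X)

/-- `E` is a holomorphic curve in `ℂP³`: a smooth complex line subbundle of `M × ℂ⁴` such that
`*δ_E = δ_E J_E`, where `J_E` is multiplication by `i`. -/
def IsHolomorphicCurve (E : M → CP3) : Prop :=
  IsLineSubbundle E ∧
    ∀ (U : Set M) (φ : M → Fin 4 → ℂ), IsOpen U → IsSection E U φ →
      ∀ p ∈ U, ∀ X : ℂ,
        delta E φ p (Complex.I * X) = delta E (fun q => Complex.I • φ q) p X

/-- `g : M → ℍP¹` is the twistor projection of `E`: the quaternionic line `g(p)` is `E_p ℍ`. -/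
def IsTwistorProjection (E : M → CP3) (g : M → HP1) : Prop :=
  ∀ p, (g p).submodule = Submodule.span (ℍ[ℝ])ᵐᵒᵖ (toH2 '' ((E p).submodule : Set (Fin 4 → ℂ)))

/-- `g : M → ℍP¹` is the twistor projection of a holomorphic curve in `ℂP³`. -/
def IsTwistorHolomorphic (g : M → HP1) : Prop :=
  ∃ E : M → CP3, IsHolomorphicCurve E ∧ IsTwistorProjection E g

end Twistor

end

end SuperConformal

namespace SuperConformal

noncomputable section

open MeasureTheory Metric
open scoped RealInnerProductSpace

/-! ### Quaternionic square roots of `-1` -/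

section Quaternions

/-! In a chart write `t` for the `x`-derivative of `f`, so that `f_y = N t = -t R`. The map `n ↦ N n
R` is an involution, equal to `1` on the tangent plane and `-1` on the normal plane, so the normal
part of `n` is `(n - N n R) / 2`. On unit tangent vectors the second fundamental form traces an
ellipse `m + cos θ u + sin θ v`, which is a circle exactly when `v = N u` or `v = -N u`.
Differentiating `f_y = N t` turns the first alternative into `N_x + N N_y = 0`, and differentiating
`f_y = -t R` turns the second into `R_x + R R_y = 0`. These are `*dN = N dN` and `*dR = R dR` at the
point (`ConformalOn.curvature_circle_iff`). Conjugation exchanges the two normals, so `N` is the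
right normal of the conjugate of `f`.

The alternative is so far pointwise, and the surface is only smooth, so passing to a global
alternative needs unique continuation. Where the defect `ρ = R_x + R R_y` is non-zero, the defect of
`N` vanishes nearby. The Codazzi equations then make `ρ`, together with the field `hopfCoeff`, a
solution of a linear first-order system with principal part `∂_y + R ∂_x`. The field `hopfCoeff`
also vanishes on open sets where `ρ` does, so the system holds everywhere by continuity
(`ConformalOn.cauchyRiemann_system`). Multiplication by `1 - R₀ R` replaces `R` by the constant `R₀`
in the principal part, and a Carleman estimate with a Gaussian weight gives unique continuation
(`eq_zero_of_cauchyRiemann_bound`). Hence the set of points near which `R` is holomorphic is open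
and closed. If it is empty, `N` is holomorphic everywhere (`forall_normalHolomorphicAt_or`).

For the twistor statement, the lift of `[f; 1]` has to consist of the vectors `(f l, l)` with `R l =
-l i`: the first component of the holomorphicity condition gives this equation. The second
component, compared with the derivative of the equation, is `*dR = R dR` (`normal_equation_iff`). -/

theorem sq_neg_one_re_normSq {K : ℍ[ℝ]} (hK : K * K = -1) :
    K.re = 0 ∧ K.imI ^ 2 + K.imJ ^ 2 + K.imK ^ 2 = 1 := by
  have h0 := congrArg QuaternionAlgebra.re hK
  have h1 := congrArg QuaternionAlgebra.imI hK
  have h2 := congrArg QuaternionAlgebra.imJ hK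
  have h3 := congrArg QuaternionAlgebra.imK hK
  simp at h0 h1 h2 h3
  have hre : K.re = 0 := by
    by_contra hne
    have e1 : K.imI = 0 := by
      apply mul_left_cancel₀ hne; linarith
    have e2 : K.imJ = 0 := by
      apply mul_left_cancel₀ hne; linarith
    have e3 : K.imK = 0 := by
      apply mul_left_cancel₀ hne; linarith
    rw [e1, e2, e3] at h0
    nlinarith [mul_self_nonneg K.re]
  refine ⟨hre, ?_⟩
  rw [hre] at h0
  linarith

theorem norm_of_sq_neg_one {K : ℍ[ℝ]} (hK : K * K = -1) : ‖K‖ = 1 := by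
  have h : ‖K‖ * ‖K‖ = 1 := by rw [← norm_mul, hK]; simp
  nlinarith [norm_nonneg K]

theorem star_of_sq_neg_one {K : ℍ[ℝ]} (hK : K * K = -1) : star K = -K := by
  obtain ⟨h, -⟩ := sq_neg_one_re_normSq hK
  ext <;> simp [h]

/-- The commutant of a square root `K` of `-1` in the quaternions is `ℝ + ℝ K`. -/
theorem exists_eq_add_smul_of_commute {K s : ℍ[ℝ]} (hK : K * K = -1) (h : s * K = K * s) :
    ∃ α β : ℝ, s = (α : ℍ[ℝ]) + β • K := by
  obtain ⟨hre, hn⟩ := sq_neg_one_re_normSq hK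
  have h1 := congrArg QuaternionAlgebra.imI h
  have h2 := congrArg QuaternionAlgebra.imJ h
  have h3 := congrArg QuaternionAlgebra.imK h
  simp [hre] at h1 h2 h3
  -- The coefficient of `K` is the scalar product of the imaginary parts. Commuting means that their
  -- cross product vanishes, and `K` has unit length.
  refine ⟨s.re, s.imI * K.imI + s.imJ * K.imJ + s.imK * K.imK, ?_⟩
  ext
  · simp [hre]
  · simp; linear_combination (-s.imI) * hn - K.imK / 2 * h2 + K.imJ / 2 * h3
  · simp; linear_combination (-s.imJ) * hn + K.imK / 2 * h1 - K.imI / 2 * h3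
  · simp; linear_combination (-s.imK) * hn - K.imJ / 2 * h1 + K.imI / 2 * h2

theorem inner_mul_mul_left {K : ℍ[ℝ]} (hK : K * K = -1) (a b : ℍ[ℝ]) :
    ⟪K * a, K * b⟫ = ⟪a, b⟫ := by
  obtain ⟨hre, hn⟩ := sq_neg_one_re_normSq hK
  simp only [Quaternion.inner_def]
  simp [hre]
  linear_combination
    (a.re * b.re + a.imI * b.imI + a.imJ * b.imJ + a.imK * b.imK) * hn

theorem inner_mul_left {K : ℍ[ℝ]} (hK : K * K = -1) (a b : ℍ[ℝ]) :
    ⟪K * a, b⟫ = -⟪a, K * b⟫ := by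
  have h := inner_mul_mul_left hK a (K * b)
  rw [← mul_assoc, hK] at h
  rw [← h]; simp

theorem inner_mul_left_self {K : ℍ[ℝ]} (hK : K * K = -1) (a : ℍ[ℝ]) :
    ⟪a, K * a⟫ = 0 := by
  have h := inner_mul_left hK a a
  rw [real_inner_comm] at h; linarith

end Quaternions

/-! ### Partial derivatives in the plane -/

section Partial

variable {F : Type*} [NormedAddCommGroup F] [NormedSpace ℝ F]

/-- The partial derivative with respect to `x`. -/
def dx (g : ℂ → F) (z : ℂ) : F := fderiv ℝ g z 1

/-- The partial derivative with respect to `y`. -/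
def dy (g : ℂ → F) (z : ℂ) : F := fderiv ℝ g z Complex.I

theorem fderiv_eq_dx_dy (g : ℂ → F) (z X : ℂ) :
    fderiv ℝ g z X = X.re • dx g z + X.im • dy g z := by
  have : X = X.re • (1 : ℂ) + X.im • Complex.I := by
    apply Complex.ext <;> simp
  conv_lhs => rw [this]
  rw [map_add, map_smul, map_smul]; rfl

theorem contDiffOn_fderiv_apply {g : ℂ → F} {Ω : Set ℂ} (hΩ : IsOpen Ω)
    (hg : ContDiffOn ℝ ∞ g Ω) (X : ℂ) : ContDiffOn ℝ ∞ (fun z => fderiv ℝ g z X) Ω :=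
  (hg.fderiv_of_isOpen hΩ (by simp)).clm_apply contDiffOn_const

theorem contDiffOn_dx {g : ℂ → F} {Ω : Set ℂ} (hΩ : IsOpen Ω)
    (hg : ContDiffOn ℝ ∞ g Ω) : ContDiffOn ℝ ∞ (dx g) Ω := contDiffOn_fderiv_apply hΩ hg 1

theorem contDiffOn_dy {g : ℂ → F} {Ω : Set ℂ} (hΩ : IsOpen Ω)
    (hg : ContDiffOn ℝ ∞ g Ω) : ContDiffOn ℝ ∞ (dy g) Ω := contDiffOn_fderiv_apply hΩ hg Complex.I

theorem differentiableAt_of_contDiffOn {g : ℂ → F} {Ω : Set ℂ} (hΩ : IsOpen Ω)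
    (hg : ContDiffOn ℝ ∞ g Ω) {z : ℂ} (hz : z ∈ Ω) : DifferentiableAt ℝ g z :=
  (hg.contDiffAt (hΩ.mem_nhds hz)).differentiableAt (by simp)

theorem fderiv_fderiv_apply {g : ℂ → F} {z : ℂ} (hg : ContDiffAt ℝ 2 g z) (X Y : ℂ) :
    fderiv ℝ (fun z => fderiv ℝ g z Y) z X = fderiv ℝ (fderiv ℝ g) z X Y := by
  have h : DifferentiableAt ℝ (fderiv ℝ g) z :=
    (hg.fderiv_right (m := 1) (by norm_num)).differentiableAt (by norm_num)
  rw [fderiv_clm_apply h (differentiableAt_const Y)]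
  simp

theorem dx_dy_comm {g : ℂ → F} {z : ℂ} (hg : ContDiffAt ℝ 2 g z) :
    dx (dy g) z = dy (dx g) z := by
  have h1 := fderiv_fderiv_apply hg 1 Complex.I
  have h2 := fderiv_fderiv_apply hg Complex.I 1
  have h3 : IsSymmSndFDerivAt ℝ g z := hg.isSymmSndFDerivAt (by simp)
  exact h1.trans ((h3 1 Complex.I).trans h2.symm)

theorem dx_congr {g h : ℂ → F} {z : ℂ} (e : g =ᶠ[nhds z] h) : dx g z = dx h z := by
  rw [dx, e.fderiv_eq, dx]

theorem dy_congr {g h : ℂ → F} {z : ℂ} (e : g =ᶠ[nhds z] h) : dy g z = dy h z := by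
  rw [dy, e.fderiv_eq, dy]

theorem dx_add {g h : ℂ → F} {z : ℂ} (hg : DifferentiableAt ℝ g z)
    (hh : DifferentiableAt ℝ h z) : dx (fun z => g z + h z) z = dx g z + dx h z := by
  simp [dx, fderiv_fun_add hg hh]

theorem dy_add {g h : ℂ → F} {z : ℂ} (hg : DifferentiableAt ℝ g z)
    (hh : DifferentiableAt ℝ h z) : dy (fun z => g z + h z) z = dy g z + dy h z := by
  simp [dy, fderiv_fun_add hg hh]

theorem dx_sub {g h : ℂ → F} {z : ℂ} (hg : DifferentiableAt ℝ g z)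
    (hh : DifferentiableAt ℝ h z) : dx (fun z => g z - h z) z = dx g z - dx h z := by
  simp [dx, fderiv_fun_sub hg hh]

theorem dy_sub {g h : ℂ → F} {z : ℂ} (hg : DifferentiableAt ℝ g z)
    (hh : DifferentiableAt ℝ h z) : dy (fun z => g z - h z) z = dy g z - dy h z := by
  simp [dy, fderiv_fun_sub hg hh]

theorem dx_neg (g : ℂ → F) (z : ℂ) : dx (fun z => -g z) z = -dx g z := by
  simp [dx, fderiv_fun_neg]

theorem dy_neg (g : ℂ → F) (z : ℂ) : dy (fun z => -g z) z = -dy g z := by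
  simp [dy, fderiv_fun_neg]

theorem dx_smul {c : ℂ → ℝ} {g : ℂ → F} {z : ℂ} (hc : DifferentiableAt ℝ c z)
    (hg : DifferentiableAt ℝ g z) :
    dx (fun z => c z • g z) z = c z • dx g z + dx c z • g z := by
  simp [dx, fderiv_fun_smul hc hg]

theorem dy_smul {c : ℂ → ℝ} {g : ℂ → F} {z : ℂ} (hc : DifferentiableAt ℝ c z)
    (hg : DifferentiableAt ℝ g z) :
    dy (fun z => c z • g z) z = c z • dy g z + dy c z • g z := by
  simp [dy, fderiv_fun_smul hc hg]

theorem dx_mul {A : Type*} [NormedRing A] [NormedAlgebra ℝ A] {g h : ℂ → A} {z : ℂ}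
    (hg : DifferentiableAt ℝ g z) (hh : DifferentiableAt ℝ h z) :
    dx (fun z => g z * h z) z = g z * dx h z + dx g z * h z := by
  simp [dx, fderiv_fun_mul' hg hh]

theorem dy_mul {A : Type*} [NormedRing A] [NormedAlgebra ℝ A] {g h : ℂ → A} {z : ℂ}
    (hg : DifferentiableAt ℝ g z) (hh : DifferentiableAt ℝ h z) :
    dy (fun z => g z * h z) z = g z * dy h z + dy g z * h z := by
  simp [dy, fderiv_fun_mul' hg hh]

theorem dx_const (c : F) (z : ℂ) : dx (fun _ => c) z = 0 := by simp [dx]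

theorem dy_const (c : F) (z : ℂ) : dy (fun _ => c) z = 0 := by simp [dy]

variable {V : Type*} [NormedAddCommGroup V] [InnerProductSpace ℝ V]

theorem dx_inner {g h : ℂ → V} {z : ℂ} (hg : DifferentiableAt ℝ g z)
    (hh : DifferentiableAt ℝ h z) :
    dx (fun z => ⟪g z, h z⟫) z = ⟪g z, dx h z⟫ + ⟪dx g z, h z⟫ := by
  simp [dx, fderiv_inner_apply ℝ hg hh]

theorem dy_inner {g h : ℂ → V} {z : ℂ} (hg : DifferentiableAt ℝ g z)
    (hh : DifferentiableAt ℝ h z) :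
    dy (fun z => ⟪g z, h z⟫) z = ⟪g z, dy h z⟫ + ⟪dy g z, h z⟫ := by
  simp [dy, fderiv_inner_apply ℝ hg hh]

end Partial

/-! ### A Carleman estimate for the Cauchy-Riemann operator `∂_y + K ∂_x` -/

section Carleman

theorem integral_fderiv_apply_eq_zero {g : ℂ → ℝ} (hg : ContDiff ℝ 1 g)
    (hc : HasCompactSupport g) (v : ℂ) :
    Integrable (fun z => fderiv ℝ g z v) ∧ ∫ z, fderiv ℝ g z v = 0 := by
  have hc' : HasCompactSupport (fun z => fderiv ℝ g z v) := hc.fderiv_apply (𝕜 := ℝ) v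
  have hcont : Continuous (fun z => fderiv ℝ g z v) :=
    (hg.continuous_fderiv (by norm_num)).clm_apply continuous_const
  have hi := hcont.integrable_of_hasCompactSupport (μ := volume) hc'
  refine ⟨hi, ?_⟩
  have h := integral_mul_fderiv_eq_neg_fderiv_mul_of_integrable (μ := volume)
    (f := fun _ : ℂ => (1 : ℝ)) (g := g) (v := v) (by simp) (by simpa using hi)
    (by simpa using hg.continuous.integrable_of_hasCompactSupport hc) (by simp)
    (fun x _ => hg.differentiable (by norm_num) x)
  simpa using h

theorem integral_le_of_add_sub_le {a b g h : ℂ → ℝ} (ha : Integrable a) (hg : Integrable g)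
    (hh : Integrable h) (hb : Integrable b) (hg0 : ∫ z, g z = 0) (hh0 : ∫ z, h z = 0)
    (hle : ∀ z, a z + g z - h z ≤ b z) : ∫ z, a z ≤ ∫ z, b z := by
  have h1 := integral_mono (f := fun z => a z + g z - h z) ((ha.add hg).sub hh) hb hle
  have h2 : ∫ z, (a z + g z - h z) = (∫ z, a z + g z) - ∫ z, h z := integral_sub (ha.add hg) hh
  have h3 : ∫ z, (a z + g z) = (∫ z, a z) + ∫ z, g z := integral_add ha hg
  linarith

/-- The pointwise divergence identity behind the Carleman estimate. -/
theorem carleman_pointwise {K : ℍ[ℝ]} (hK : K * K = -1) {w : ℂ → ℍ[ℝ]} {φ : ℂ → ℝ}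
    (hw : ContDiff ℝ ∞ w) (hφ : ContDiff ℝ ∞ φ) (z : ℂ) :
    (dx (dx φ) z + dy (dy φ) z) * ‖w z‖ ^ 2
      + dy (fun z => ⟪w z, K * dx w z⟫ - dy φ z * ⟪w z, w z⟫) z
      - dx (fun z => ⟪w z, K * dy w z⟫ + dx φ z * ⟪w z, w z⟫) z
      ≤ ‖(dy w z - dy φ z • w z) + K * (dx w z - dx φ z • w z)‖ ^ 2 := by
  have D : ∀ {F : Type} [NormedAddCommGroup F] [NormedSpace ℝ F] {g : ℂ → F},
      ContDiff ℝ ∞ g → DifferentiableAt ℝ g z := fun hg => hg.differentiable (by simp) z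
  have hwx : ContDiff ℝ ∞ (dx w) :=
    contDiffOn_univ.1 (contDiffOn_dx isOpen_univ hw.contDiffOn)
  have hwy : ContDiff ℝ ∞ (dy w) :=
    contDiffOn_univ.1 (contDiffOn_dy isOpen_univ hw.contDiffOn)
  have hφx : ContDiff ℝ ∞ (dx φ) :=
    contDiffOn_univ.1 (contDiffOn_dx isOpen_univ hφ.contDiffOn)
  have hφy : ContDiff ℝ ∞ (dy φ) :=
    contDiffOn_univ.1 (contDiffOn_dy isOpen_univ hφ.contDiffOn)
  have hww : ContDiff ℝ ∞ (fun z => ⟪w z, w z⟫) := hw.inner ℝ hw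
  have hKx : ContDiff ℝ ∞ (fun z => K * dx w z) := contDiff_const.mul hwx
  have hKy : ContDiff ℝ ∞ (fun z => K * dy w z) := contDiff_const.mul hwy
  have e1 : dy (fun z => ⟪w z, K * dx w z⟫ - dy φ z * ⟪w z, w z⟫) z
      = ⟪w z, K * dy (dx w) z⟫ + ⟪dy w z, K * dx w z⟫
        - (dy φ z * (2 * ⟪w z, dy w z⟫) + dy (dy φ) z * ⟪w z, w z⟫) := by
    rw [dy_sub (D (hw.inner ℝ hKx)) (D (hφy.mul hww)), dy_inner (D hw) (D hKx),
      dy_mul (D hφy) (D hww), dy_inner (D hw) (D hw), dy_mul (D contDiff_const) (D hwx),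
      dy_const, real_inner_comm (w z) (dy w z)]
    rw [zero_mul, add_zero]; ring
  have e2 : dx (fun z => ⟪w z, K * dy w z⟫ + dx φ z * ⟪w z, w z⟫) z
      = ⟪w z, K * dx (dy w) z⟫ + ⟪dx w z, K * dy w z⟫
        + (dx φ z * (2 * ⟪w z, dx w z⟫) + dx (dx φ) z * ⟪w z, w z⟫) := by
    rw [dx_add (D (hw.inner ℝ hKy)) (D (hφx.mul hww)), dx_inner (D hw) (D hKy),
      dx_mul (D hφx) (D hww), dx_inner (D hw) (D hw), dx_mul (D contDiff_const) (D hwy),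
      dx_const, real_inner_comm (w z) (dx w z)]
    rw [zero_mul, add_zero]; ring
  have e3 : dx (dy w) z = dy (dx w) z :=
    dx_dy_comm (contDiff_infty.1 hw 2).contDiffAt
  rw [e1, e2, e3]
  -- Regrouping of the conjugated operator into a skew-adjoint part `∂_y - φ_x K` and a self-adjoint
  -- part `K ∂_x - φ_y`. Twice their inner product is, up to divergences, the commutator term `Δφ
  -- |w|²`, and dropping the two squares gives the inequality.
  have e4 : (dy w z - dy φ z • w z) + K * (dx w z - dx φ z • w z)
      = (dy w z - dx φ z • (K * w z)) + (K * dx w z - dy φ z • w z) := by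
    rw [mul_sub, mul_smul_comm]; abel
  rw [e4, @norm_add_sq_real]
  have e5 : ⟪dy w z - dx φ z • (K * w z), K * dx w z - dy φ z • w z⟫
      = ⟪dy w z, K * dx w z⟫ - dy φ z * ⟪w z, dy w z⟫ - dx φ z * ⟪w z, dx w z⟫ := by
    simp only [inner_sub_left, inner_sub_right, real_inner_smul_left, real_inner_smul_right]
    rw [inner_mul_mul_left hK, inner_mul_left hK (w z) (w z), inner_mul_left_self hK,
      real_inner_comm (w z) (dy w z)]
    ring
  have e6 : ⟪dx w z, K * dy w z⟫ = -⟪dy w z, K * dx w z⟫ := by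
    rw [← inner_mul_left hK, real_inner_comm]
  rw [e5, e6, real_inner_self_eq_norm_sq]
  nlinarith [sq_nonneg ‖dy w z - dx φ z • (K * w z)‖,
    sq_nonneg ‖K * dx w z - dy φ z • w z‖]

theorem carleman_conjugated {K : ℍ[ℝ]} (hK : K * K = -1) {w : ℂ → ℍ[ℝ]} {φ : ℂ → ℝ}
    (hw : ContDiff ℝ ∞ w) (hφ : ContDiff ℝ ∞ φ) (hc : HasCompactSupport w) :
    ∫ z, (dx (dx φ) z + dy (dy φ) z) * ‖w z‖ ^ 2
      ≤ ∫ z, ‖(dy w z - dy φ z • w z) + K * (dx w z - dx φ z • w z)‖ ^ 2 := by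
  have hwx : ContDiff ℝ ∞ (dx w) :=
    contDiffOn_univ.1 (contDiffOn_dx isOpen_univ hw.contDiffOn)
  have hwy : ContDiff ℝ ∞ (dy w) :=
    contDiffOn_univ.1 (contDiffOn_dy isOpen_univ hw.contDiffOn)
  have hφx : ContDiff ℝ ∞ (dx φ) :=
    contDiffOn_univ.1 (contDiffOn_dx isOpen_univ hφ.contDiffOn)
  have hφy : ContDiff ℝ ∞ (dy φ) :=
    contDiffOn_univ.1 (contDiffOn_dy isOpen_univ hφ.contDiffOn)
  have hφxx : ContDiff ℝ ∞ (dx (dx φ)) :=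
    contDiffOn_univ.1 (contDiffOn_dx isOpen_univ hφx.contDiffOn)
  have hφyy : ContDiff ℝ ∞ (dy (dy φ)) :=
    contDiffOn_univ.1 (contDiffOn_dy isOpen_univ hφy.contDiffOn)
  have hww : ContDiff ℝ ∞ (fun z => ⟪w z, w z⟫) := hw.inner ℝ hw
  have hKx : ContDiff ℝ ∞ (fun z => K * dx w z) := contDiff_const.mul hwx
  have hKy : ContDiff ℝ ∞ (fun z => K * dy w z) := contDiff_const.mul hwy
  have h1 := integral_fderiv_apply_eq_zero
    (g := fun z => ⟪w z, K * dx w z⟫ - dy φ z * ⟪w z, w z⟫)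
    (((hw.inner ℝ hKx).sub (hφy.mul hww)).of_le (by simp))
    (hc.mono' (by
      intro z hz
      apply subset_tsupport
      intro h0; apply hz; simp [h0])) Complex.I
  have h2 := integral_fderiv_apply_eq_zero
    (g := fun z => ⟪w z, K * dy w z⟫ + dx φ z * ⟪w z, w z⟫)
    (((hw.inner ℝ hKy).add (hφx.mul hww)).of_le (by simp))
    (hc.mono' (by
      intro z hz
      apply subset_tsupport
      intro h0; apply hz; simp [h0])) 1
  have hi : Integrable (fun z => (dx (dx φ) z + dy (dy φ) z) * ‖w z‖ ^ 2) := by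
    apply Continuous.integrable_of_hasCompactSupport
    · exact (hφxx.continuous.add hφyy.continuous).mul (hw.continuous.norm.pow 2)
    · refine hc.mono' ?_
      intro z hz
      apply subset_tsupport
      intro h0; apply hz; simp [h0]
  have hr : Integrable
      (fun z => ‖(dy w z - dy φ z • w z) + K * (dx w z - dx φ z • w z)‖ ^ 2) := by
    apply Continuous.integrable_of_hasCompactSupport
    · exact (((hwy.sub (hφy.smul hw)).add
        (contDiff_const.mul (hwx.sub (hφx.smul hw)))).continuous.norm.pow 2)
    · refine hc.mono' fun z hz => ?_
      by_contra h0
      have hw0 := image_eq_zero_of_notMem_tsupport h0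
      have hx0 : dx w z = 0 := by
        rw [dx, image_eq_zero_of_notMem_tsupport (fun h => h0 (tsupport_fderiv_subset ℝ h))]
        rfl
      have hy0 : dy w z = 0 := by
        rw [dy, image_eq_zero_of_notMem_tsupport (fun h => h0 (tsupport_fderiv_subset ℝ h))]
        rfl
      exact hz (by simp only [hw0, hx0, hy0]; simp)
  exact integral_le_of_add_sub_le hi h1.1 h2.1 hr h1.2 h2.2 (carleman_pointwise hK hw hφ)

/-- The Carleman estimate with weight `exp (2 φ)`. -/
theorem carleman {K : ℍ[ℝ]} (hK : K * K = -1) {v : ℂ → ℍ[ℝ]} {φ : ℂ → ℝ}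
    (hv : ContDiff ℝ ∞ v) (hφ : ContDiff ℝ ∞ φ) (hc : HasCompactSupport v) :
    ∫ z, (dx (dx φ) z + dy (dy φ) z) * (Real.exp (2 * φ z) * ‖v z‖ ^ 2)
      ≤ ∫ z, Real.exp (2 * φ z) * ‖dy v z + K * dx v z‖ ^ 2 := by
  have he : ContDiff ℝ ∞ (fun z => Real.exp (φ z)) := hφ.exp
  -- The substitution `w = exp(φ) v` turns `∂_y + K ∂_x` into the conjugated operator of
  -- `carleman_conjugated`.
  have hw : ContDiff ℝ ∞ (fun z => Real.exp (φ z) • v z) := he.smul hv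
  have hwc : HasCompactSupport (fun z => Real.exp (φ z) • v z) := hc.mono' fun z hz => by
    apply subset_tsupport
    intro h0; apply hz; simp only [h0, smul_zero]
  have h := carleman_conjugated hK hw hφ hwc
  have hE : ∀ z, Real.exp (φ z) ^ 2 = Real.exp (2 * φ z) := by
    intro z; rw [← Real.exp_nat_mul]; norm_num
  have hx : ∀ z, dx (fun z => Real.exp (φ z)) z = Real.exp (φ z) * dx φ z := by
    intro z
    simp [dx, fderiv_exp (hφ.differentiable (by simp) z)]
  have hy : ∀ z, dy (fun z => Real.exp (φ z)) z = Real.exp (φ z) * dy φ z := by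
    intro z
    simp [dy, fderiv_exp (hφ.differentiable (by simp) z)]
  have hl : ∀ z, (dx (dx φ) z + dy (dy φ) z) * (Real.exp (2 * φ z) * ‖v z‖ ^ 2)
      = (dx (dx φ) z + dy (dy φ) z) * ‖Real.exp (φ z) • v z‖ ^ 2 := by
    intro z
    rw [norm_smul, mul_pow, Real.norm_eq_abs, sq_abs, hE]
  have hr : ∀ z, Real.exp (2 * φ z) * ‖dy v z + K * dx v z‖ ^ 2
      = ‖(dy (fun z => Real.exp (φ z) • v z) z - dy φ z • (Real.exp (φ z) • v z))
        + K * (dx (fun z => Real.exp (φ z) • v z) z - dx φ z • (Real.exp (φ z) • v z))‖ ^ 2 := by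
    intro z
    have hd := he.differentiable (by simp) z
    have hd' := hv.differentiable (by simp) z
    rw [dx_smul hd hd', dy_smul hd hd', hx, hy]
    have : Real.exp (φ z) • dy v z + (Real.exp (φ z) * dy φ z) • v z - dy φ z • Real.exp (φ z) • v z
        + K * (Real.exp (φ z) • dx v z + (Real.exp (φ z) * dx φ z) • v z
          - dx φ z • Real.exp (φ z) • v z)
        = Real.exp (φ z) • (dy v z + K * dx v z) := by
      rw [smul_smul, smul_smul, mul_comm (dx φ z), mul_comm (dy φ z), add_sub_cancel_right,
        add_sub_cancel_right, mul_smul_comm, smul_add]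
    rw [this, norm_smul, mul_pow, Real.norm_eq_abs, sq_abs, hE]
  rw [integral_congr_ae (Filter.Eventually.of_forall hl),
    integral_congr_ae (Filter.Eventually.of_forall hr)]
  exact h

end Carleman

/-! ### Unique continuation for Cauchy-Riemann inequalities -/

section UniqueContinuation

/-- The Gaussian weight `τ exp (-k |z - q|²)`. -/
def gaussWeight (τ k : ℝ) (q z : ℂ) : ℝ :=
  τ * Real.exp (-k * ((z.re - q.re) ^ 2 + (z.im - q.im) ^ 2))

theorem contDiff_re : ContDiff ℝ ∞ (fun z : ℂ => z.re) := Complex.reCLM.contDiff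

theorem contDiff_im : ContDiff ℝ ∞ (fun z : ℂ => z.im) := Complex.imCLM.contDiff

theorem contDiff_gaussWeight (τ k : ℝ) (q : ℂ) : ContDiff ℝ ∞ (gaussWeight τ k q) :=
  contDiff_const.mul (contDiff_const.mul (((contDiff_re.sub contDiff_const).pow 2).add
    ((contDiff_im.sub contDiff_const).pow 2))).exp

theorem hasFDerivAt_gaussWeight (τ k : ℝ) (q z : ℂ) :
    HasFDerivAt (gaussWeight τ k q) (gaussWeight τ k q z • ((-k) •
      ((2 * (z.re - q.re)) • Complex.reCLM + (2 * (z.im - q.im)) • Complex.imCLM))) z := by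
  have h1 : HasFDerivAt (fun z : ℂ => z.re - q.re) Complex.reCLM z :=
    Complex.reCLM.hasFDerivAt.sub_const _
  have h2 : HasFDerivAt (fun z : ℂ => z.im - q.im) Complex.imCLM z :=
    Complex.imCLM.hasFDerivAt.sub_const _
  have h := ((((h1.pow 2).add (h2.pow 2)).const_mul (-k)).exp).const_mul τ
  refine h.congr_fderiv ?_
  ext X
  simp [gaussWeight]
  ring

theorem dx_gaussWeight (τ k : ℝ) (q : ℂ) :
    dx (gaussWeight τ k q) = fun z => gaussWeight τ k q z * (-2 * k * (z.re - q.re)) := by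
  ext z
  rw [dx, (hasFDerivAt_gaussWeight τ k q z).fderiv]
  simp; left; ring

theorem dy_gaussWeight (τ k : ℝ) (q : ℂ) :
    dy (gaussWeight τ k q) = fun z => gaussWeight τ k q z * (-2 * k * (z.im - q.im)) := by
  ext z
  rw [dy, (hasFDerivAt_gaussWeight τ k q z).fderiv]
  simp; left; ring

/-- The factor `k |z - q|² - 1` is positive only away from the centre. This is why the Carleman
estimate is applied to functions that vanish near `q`. -/
theorem laplacian_gaussWeight (τ k : ℝ) (q z : ℂ) :
    dx (dx (gaussWeight τ k q)) z + dy (dy (gaussWeight τ k q)) z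
      = 4 * k * (k * ((z.re - q.re) ^ 2 + (z.im - q.im) ^ 2) - 1) * gaussWeight τ k q z := by
  have hd : DifferentiableAt ℝ (gaussWeight τ k q) z :=
    (hasFDerivAt_gaussWeight τ k q z).differentiableAt
  have h1 : HasFDerivAt (fun z : ℂ => -2 * k * (z.re - q.re)) ((-2 * k) • Complex.reCLM) z :=
    (Complex.reCLM.hasFDerivAt.sub_const _).const_mul _
  have h2 : HasFDerivAt (fun z : ℂ => -2 * k * (z.im - q.im)) ((-2 * k) • Complex.imCLM) z :=
    (Complex.imCLM.hasFDerivAt.sub_const _).const_mul _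
  have e1 : dx (fun z : ℂ => -2 * k * (z.re - q.re)) z = -2 * k := by
    rw [dx, h1.fderiv]; simp
  have e2 : dy (fun z : ℂ => -2 * k * (z.im - q.im)) z = -2 * k := by
    rw [dy, h2.fderiv]; simp
  rw [dx_gaussWeight, dy_gaussWeight, dx_mul hd h1.differentiableAt,
    dy_mul hd h2.differentiableAt, e1, e2, dx_gaussWeight, dy_gaussWeight]
  ring

theorem sq_add_sq_eq_dist_sq (q z : ℂ) :
    (z.re - q.re) ^ 2 + (z.im - q.im) ^ 2 = dist z q ^ 2 := by
  rw [Complex.dist_eq, Complex.sq_norm, Complex.normSq_apply]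
  simp; ring

theorem gaussWeight_eq (τ k : ℝ) (q z : ℂ) :
    gaussWeight τ k q z = τ * Real.exp (-k * dist z q ^ 2) := by
  rw [gaussWeight, sq_add_sq_eq_dist_sq]

theorem gaussWeight_le {τ k b : ℝ} {q z : ℂ} (hτ : 0 ≤ τ) (hk : 0 ≤ k) (hb : 0 ≤ b)
    (hz : b ≤ dist z q) : gaussWeight τ k q z ≤ τ * Real.exp (-k * b ^ 2) := by
  rw [gaussWeight_eq]
  gcongr _ * Real.exp ?_
  have : b ^ 2 ≤ dist z q ^ 2 := by gcongr
  nlinarith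

theorem le_gaussWeight {τ k b : ℝ} {q z : ℂ} (hτ : 0 ≤ τ) (hk : 0 ≤ k)
    (hz : dist z q ≤ b) : τ * Real.exp (-k * b ^ 2) ≤ gaussWeight τ k q z := by
  rw [gaussWeight_eq]
  gcongr _ * Real.exp ?_
  have : dist z q ^ 2 ≤ b ^ 2 := by gcongr
  nlinarith

/-- The support of the bump lies inside the disc on which `v` is smooth, so extension by zero costs
no regularity. -/
theorem contDiff_bump_smul {F : Type*} [NormedAddCommGroup F] [NormedSpace ℝ F] {v : ℂ → F}
    {q : ℂ} {r : ℝ} (hv : ContDiffOn ℝ ∞ v (ball q r)) (χ : ContDiffBump q) (hr : χ.rOut < r) :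
    ContDiff ℝ ∞ (fun z => χ z • v z) := by
  rw [contDiff_iff_contDiffAt]
  intro z
  by_cases hz : z ∈ ball q r
  · exact χ.contDiffAt.smul (hv.contDiffAt (isOpen_ball.mem_nhds hz))
  · have hz' : z ∈ (closedBall q χ.rOut)ᶜ := by
      simp only [Set.mem_compl_iff, mem_closedBall, mem_ball, not_le, not_lt] at hz ⊢
      linarith
    have : (fun z => χ z • v z) =ᶠ[nhds z] fun _ => 0 := by
      filter_upwards [isClosed_closedBall.isOpen_compl.mem_nhds hz'] with y hy
      rw [χ.zero_of_le_dist (by simpa using le_of_lt (by simpa using hy)), zero_smul]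
    exact contDiffAt_const.congr_of_eventuallyEq this

/-- The Carleman estimate with Gaussian weight for a function that vanishes near the centre. -/
theorem gauss_carleman {K : ℍ[ℝ]} (hK : K * K = -1) {V : ℂ → ℍ[ℝ]} {q : ℂ} {ε c τ : ℝ}
    (hε : 0 < ε) (hτ : 0 ≤ τ) (hV : ContDiff ℝ ∞ V) (hVε : ∀ z ∈ ball q ε, V z = 0)
    (hVc : ∀ z, c ≤ dist z q → V z = 0) :
    4 * (2 / ε ^ 2) * (τ * Real.exp (-(2 / ε ^ 2) * c ^ 2))
        * ∫ z, Real.exp (2 * gaussWeight τ (2 / ε ^ 2) q z) * ‖V z‖ ^ 2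
      ≤ ∫ z, Real.exp (2 * gaussWeight τ (2 / ε ^ 2) q z) * ‖dy V z + K * dx V z‖ ^ 2 := by
  -- With this rate `k |z - q|² - 1 ≥ 1` outside the disc of radius `ε`, while inside it `V`
  -- vanishes. The weight is smallest at the outer radius `c`, which gives the uniform lower bound
  -- for the Laplacian.
  set k := 2 / ε ^ 2 with hk
  have hk0 : 0 < k := by positivity
  have hcpt : HasCompactSupport V := by
    refine HasCompactSupport.intro (isCompact_closedBall q c) fun z hz => hVc z ?_
    simp at hz; exact hz.le
  refine le_trans ?_ (carleman hK hV (contDiff_gaussWeight τ k q) hcpt)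
  rw [← integral_const_mul]
  have hcont : Continuous fun z => Real.exp (2 * gaussWeight τ k q z) * ‖V z‖ ^ 2 :=
    (Real.continuous_exp.comp (continuous_const.mul (contDiff_gaussWeight τ k q).continuous)).mul
      (hV.continuous.norm.pow 2)
  have hsupp : ∀ h : ℂ → ℝ, HasCompactSupport
      (fun z => h z * (Real.exp (2 * gaussWeight τ k q z) * ‖V z‖ ^ 2)) := fun h =>
    hcpt.mono' fun z hz => by
      apply subset_tsupport
      intro h0; apply hz; simp [h0]
  refine integral_mono ?_ ?_ ?_
  · exact (continuous_const.mul hcont).integrable_of_hasCompactSupport (hsupp _)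
  · refine Continuous.integrable_of_hasCompactSupport (Continuous.mul ?_ hcont) (hsupp _)
    simp only [laplacian_gaussWeight]
    have := (contDiff_gaussWeight τ k q).continuous
    fun_prop
  · intro z
    simp only [laplacian_gaussWeight, sq_add_sq_eq_dist_sq]
    by_cases h1 : dist z q < ε
    · simp [hVε z h1]
    by_cases h2 : c ≤ dist z q
    · simp [hVc z h2]
    rw [not_lt] at h1
    rw [not_le] at h2
    have h3 : 1 ≤ k * dist z q ^ 2 - 1 := by
      have : ε ^ 2 ≤ dist z q ^ 2 := by gcongr
      have h4 : k * ε ^ 2 = 2 := by rw [hk]; field_simp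
      nlinarith
    have h5 := le_gaussWeight (q := q) (z := z) hτ hk0.le h2.le
    have h6 : 0 ≤ τ * Real.exp (-k * c ^ 2) := by positivity
    apply mul_le_mul_of_nonneg_right _ (by positivity)
    rw [mul_assoc (4 * k)]
    apply mul_le_mul_of_nonneg_left _ (by positivity)
    nlinarith

/-- A pair of quaternionic functions satisfying a Cauchy-Riemann inequality on a disc vanishes
if it vanishes near the centre. -/
theorem eq_zero_of_cauchyRiemann_bound {K : ℍ[ℝ]} (hK : K * K = -1) {v₁ v₂ : ℂ → ℍ[ℝ]} {q : ℂ}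
    {r C ε : ℝ} (hv₁ : ContDiffOn ℝ ∞ v₁ (ball q r)) (hv₂ : ContDiffOn ℝ ∞ v₂ (ball q r))
    (hb₁ : ∀ z ∈ ball q r, ‖dy v₁ z + K * dx v₁ z‖ ≤ C * (‖v₁ z‖ + ‖v₂ z‖))
    (hb₂ : ∀ z ∈ ball q r, ‖dy v₂ z + K * dx v₂ z‖ ≤ C * (‖v₁ z‖ + ‖v₂ z‖))
    (hε : 0 < ε) (h₁ : ∀ z ∈ ball q ε, v₁ z = 0) (h₂ : ∀ z ∈ ball q ε, v₂ z = 0) :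
    ∀ z ∈ ball q r, v₁ z = 0 ∧ v₂ z = 0 := by
  intro p hp
  -- Radii `dist p q < d < a < b < c < r`. The cutoff `χ` falls from `1` to `0` between `b` and `c`,
  -- and `ψ` between `d` and `a`. The gap between `a` and `b` makes the weight on the region of
  -- interest strictly larger than the weight where `χ` varies.
  obtain ⟨d, hpd, hdr⟩ := exists_between (mem_ball.1 hp)
  obtain ⟨a, hda, har⟩ := exists_between hdr
  obtain ⟨b, hab, hbr⟩ := exists_between har
  obtain ⟨c, hbc, hcr⟩ := exists_between hbr
  have hd0 : 0 < d := dist_nonneg.trans_lt hpd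
  let χ : ContDiffBump q := ⟨b, c, by linarith, hbc⟩
  let ψ : ContDiffBump q := ⟨d, a, hd0, hda⟩
  have hV₁ := contDiff_bump_smul hv₁ χ hcr
  have hV₂ := contDiff_bump_smul hv₂ χ hcr
  set V₁ := fun z => χ z • v₁ z with hV₁def
  set V₂ := fun z => χ z • v₂ z with hV₂def
  have hVε₁ : ∀ z ∈ ball q ε, V₁ z = 0 := fun z hz => by simp only [hV₁def, h₁ z hz, smul_zero]
  have hVε₂ : ∀ z ∈ ball q ε, V₂ z = 0 := fun z hz => by simp only [hV₂def, h₂ z hz, smul_zero]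
  have hVc₁ : ∀ z, c ≤ dist z q → V₁ z = 0 := fun z hz => by
    simp only [hV₁def, χ.zero_of_le_dist hz, zero_smul]
  have hVc₂ : ∀ z, c ≤ dist z q → V₂ z = 0 := fun z hz => by
    simp only [hV₂def, χ.zero_of_le_dist hz, zero_smul]
  have hDV : ∀ {V : ℂ → ℍ[ℝ]}, ContDiff ℝ ∞ V → Continuous fun z => dy V z + K * dx V z :=
    fun hV => ((contDiffOn_univ.1 (contDiffOn_dy isOpen_univ hV.contDiffOn)).add
      (contDiff_const.mul (contDiffOn_univ.1 (contDiffOn_dx isOpen_univ hV.contDiffOn)))).continuous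
  -- a bound for the derivatives on the whole disc
  obtain ⟨B, hB₁, hB₂⟩ : ∃ B : ℝ, (∀ z ∈ closedBall q c, ‖dy V₁ z + K * dx V₁ z‖ ^ 2 ≤ B) ∧
      ∀ z ∈ closedBall q c, ‖dy V₂ z + K * dx V₂ z‖ ^ 2 ≤ B := by
    obtain ⟨B₁, hB₁⟩ := (isCompact_closedBall q c).bddAbove_image
      ((hDV hV₁).norm.pow 2).continuousOn
    obtain ⟨B₂, hB₂⟩ := (isCompact_closedBall q c).bddAbove_image
      ((hDV hV₂).norm.pow 2).continuousOn
    exact ⟨max B₁ B₂, fun z hz => (hB₁ ⟨z, hz, rfl⟩).trans (le_max_left _ _),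
      fun z hz => (hB₂ ⟨z, hz, rfl⟩).trans (le_max_right _ _)⟩
  set k := 2 / ε ^ 2 with hk
  have hk0 : 0 < k := by positivity
  set α := Real.exp (-k * a ^ 2) with hα
  set β := Real.exp (-k * b ^ 2) with hβ
  have hβα : β < α := by
    apply Real.exp_lt_exp.2
    have : a ^ 2 < b ^ 2 := by gcongr; linarith
    nlinarith
  -- the pointwise estimate of the right hand side
  have key : ∀ (v V : ℂ → ℍ[ℝ]), (V = fun z => χ z • v z) →
      (∀ z ∈ ball q r, ‖dy v z + K * dx v z‖ ≤ C * (‖v₁ z‖ + ‖v₂ z‖)) →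
      (∀ z ∈ closedBall q c, ‖dy V z + K * dx V z‖ ^ 2 ≤ B) → ∀ τ : ℝ, 0 ≤ τ → ∀ z,
      Real.exp (2 * gaussWeight τ k q z) * ‖dy V z + K * dx V z‖ ^ 2
        ≤ 2 * C ^ 2 * (Real.exp (2 * gaussWeight τ k q z) * ‖V₁ z‖ ^ 2
            + Real.exp (2 * gaussWeight τ k q z) * ‖V₂ z‖ ^ 2)
          + (closedBall q c).indicator (fun _ => B * Real.exp (2 * (τ * β))) z := by
    intro v V hVv hv hB τ hτ z
    have hpos : 0 ≤ 2 * C ^ 2 * (Real.exp (2 * gaussWeight τ k q z) * ‖V₁ z‖ ^ 2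
            + Real.exp (2 * gaussWeight τ k q z) * ‖V₂ z‖ ^ 2) := by positivity
    by_cases hzb : dist z q < b
    · have hzc : z ∈ closedBall q c := by simp; linarith
      have hBn : 0 ≤ B := (by positivity : (0:ℝ) ≤ _).trans (hB z hzc)
      have hχ : χ z = 1 := χ.one_of_mem_closedBall (by simpa [χ] using hzb.le)
      have hVv' : V =ᶠ[nhds z] v := by
        filter_upwards [isOpen_ball.mem_nhds (mem_ball.2 hzb)] with y hy
        have : χ y = 1 := χ.one_of_mem_closedBall (by simpa [χ] using (mem_ball.1 hy).le)
        rw [hVv]; simp [this]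
      have e1 : V₁ z = v₁ z := by simp [hV₁def, hχ]
      have e2 : V₂ z = v₂ z := by simp [hV₂def, hχ]
      rw [dx_congr hVv', dy_congr hVv', e1, e2, Set.indicator_of_mem hzc]
      have h := hv z (by simp; linarith)
      have h' : ‖dy v z + K * dx v z‖ ^ 2 ≤ 2 * C ^ 2 * (‖v₁ z‖ ^ 2 + ‖v₂ z‖ ^ 2) := by
        have : ‖dy v z + K * dx v z‖ ^ 2 ≤ (C * (‖v₁ z‖ + ‖v₂ z‖)) ^ 2 := by gcongr
        nlinarith [sq_nonneg (C * (‖v₁ z‖ - ‖v₂ z‖))]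
      have h'' := mul_le_mul_of_nonneg_left h' (Real.exp_nonneg (2 * gaussWeight τ k q z))
      have : 0 ≤ B * Real.exp (2 * (τ * β)) := by positivity
      nlinarith
    -- In the shell where `χ` varies the differential inequality is lost. Only the crude bound `B`
    -- is available there, but the weight exponent is at most `2 τ β`.
    · rw [not_lt] at hzb
      by_cases hzc : z ∈ closedBall q c
      · rw [Set.indicator_of_mem hzc]
        have h1 := gaussWeight_le (q := q) hτ hk0.le (by linarith) hzb
        have h2 : Real.exp (2 * gaussWeight τ k q z) ≤ Real.exp (2 * (τ * β)) := by
          apply Real.exp_le_exp.2; linarith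
        have h3 := mul_le_mul h2 (hB z hzc) (by positivity) (by positivity)
        linarith
      · have hV0 : V =ᶠ[nhds z] fun _ => 0 := by
          filter_upwards [isClosed_closedBall.isOpen_compl.mem_nhds hzc] with y hy
          rw [hVv]
          simp only [χ.zero_of_le_dist (le_of_lt (by simpa using hy)), zero_smul]
        rw [dx_congr hV0, dy_congr hV0, dx_const, dy_const, Set.indicator_of_notMem hzc]
        simpa using hpos
  have hcptV : ∀ {V : ℂ → ℍ[ℝ]}, (∀ z, c ≤ dist z q → V z = 0) → HasCompactSupport V :=
    fun hV => HasCompactSupport.intro (isCompact_closedBall q c) fun z hz => hV z (by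
      simp at hz; exact hz.le)
  have hE : ∀ τ, Continuous fun z => Real.exp (2 * gaussWeight τ k q z) := fun τ =>
    Real.continuous_exp.comp (continuous_const.mul (contDiff_gaussWeight τ k q).continuous)
  have hIV : ∀ τ, ∀ {V : ℂ → ℍ[ℝ]}, ContDiff ℝ ∞ V → (∀ z, c ≤ dist z q → V z = 0) →
      Integrable fun z => Real.exp (2 * gaussWeight τ k q z) * ‖V z‖ ^ 2 := fun τ V hV hVc =>
    ((hE τ).mul (hV.continuous.norm.pow 2)).integrable_of_hasCompactSupport
      ((hcptV hVc).mono' fun z hz => by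
        apply subset_tsupport
        intro h0; apply hz; simp [h0])
  have hIB : ∀ τ, Integrable
      ((closedBall q c).indicator (fun _ : ℂ => B * Real.exp (2 * (τ * β)))) := fun τ =>
    (integrable_indicator_iff measurableSet_closedBall).2
      (integrableOn_const (isCompact_closedBall q c).measure_lt_top.ne)
  -- the function whose integral is shown to vanish
  set S : ℂ → ℝ := fun z => ψ z * (‖V₁ z‖ ^ 2 + ‖V₂ z‖ ^ 2) with hS
  have hScont : Continuous S :=
    ψ.continuous.mul ((hV₁.continuous.norm.pow 2).add (hV₂.continuous.norm.pow 2))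
  have hScpt : HasCompactSupport S := ψ.hasCompactSupport.mul_right
  have hSnn : 0 ≤ S := fun z => mul_nonneg ψ.nonneg (by positivity)
  set vol := (volume : Measure ℂ).real (closedBall q c)
  -- the integrated estimate
  have main : ∀ τ, (4 * C ^ 2 + 1) / (4 * k * Real.exp (-k * c ^ 2)) ≤ τ →
      ∫ z, S z ≤ 2 * B * vol * Real.exp (-(2 * (α - β)) * τ) := by
    intro τ hτ0
    have hτ : 0 ≤ τ := le_trans (by positivity) hτ0
    have hJ : ∀ (v V : ℂ → ℍ[ℝ]), (V = fun z => χ z • v z) →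
        (∀ z ∈ ball q r, ‖dy v z + K * dx v z‖ ≤ C * (‖v₁ z‖ + ‖v₂ z‖)) →
        (∀ z ∈ closedBall q c, ‖dy V z + K * dx V z‖ ^ 2 ≤ B) → ContDiff ℝ ∞ V →
        (∀ z ∈ ball q ε, V z = 0) → (∀ z, c ≤ dist z q → V z = 0) →
        4 * k * (τ * Real.exp (-k * c ^ 2))
            * ∫ z, Real.exp (2 * gaussWeight τ k q z) * ‖V z‖ ^ 2
          ≤ 2 * C ^ 2 * ((∫ z, Real.exp (2 * gaussWeight τ k q z) * ‖V₁ z‖ ^ 2)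
              + ∫ z, Real.exp (2 * gaussWeight τ k q z) * ‖V₂ z‖ ^ 2)
            + vol * (B * Real.exp (2 * (τ * β))) := by
      intro v V hVv hv hB hV hVε hVc
      refine (gauss_carleman hK hε hτ hV hVε hVc).trans ?_
      have hI := (((hIV τ hV₁ hVc₁).add (hIV τ hV₂ hVc₂)).const_mul (2 * C ^ 2)).add (hIB τ)
      have hle := integral_mono_of_nonneg (μ := volume)
        (Filter.Eventually.of_forall fun z => by positivity) hI
        (Filter.Eventually.of_forall (key v V hVv hv hB τ hτ))
      refine hle.trans (le_of_eq ?_)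
      rw [integral_add' (((hIV τ hV₁ hVc₁).add (hIV τ hV₂ hVc₂)).const_mul (2 * C ^ 2)) (hIB τ),
        integral_const_mul, integral_add' (hIV τ hV₁ hVc₁) (hIV τ hV₂ hVc₂),
        integral_indicator measurableSet_closedBall, setIntegral_const, smul_eq_mul]
    have hJ₁ := hJ v₁ V₁ rfl hb₁ hB₁ hV₁ hVε₁ hVc₁
    have hJ₂ := hJ v₂ V₂ rfl hb₂ hB₂ hV₂ hVε₂ hVc₂
    set I₁ := ∫ z, Real.exp (2 * gaussWeight τ k q z) * ‖V₁ z‖ ^ 2 with hI₁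
    set I₂ := ∫ z, Real.exp (2 * gaussWeight τ k q z) * ‖V₂ z‖ ^ 2 with hI₂
    have hI₁0 : 0 ≤ I₁ := integral_nonneg fun z => by positivity
    have hI₂0 : 0 ≤ I₂ := integral_nonneg fun z => by positivity
    have hlow : Real.exp (2 * (τ * α)) * ∫ z, S z ≤ I₁ + I₂ := by
      rw [hI₁, hI₂, ← integral_add (hIV τ hV₁ hVc₁) (hIV τ hV₂ hVc₂), ← integral_const_mul]
      refine integral_mono ((hScont.integrable_of_hasCompactSupport hScpt).const_mul _)
        ((hIV τ hV₁ hVc₁).add (hIV τ hV₂ hVc₂)) fun z => ?_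
      simp only [hS, ← mul_add]
      by_cases hz : a ≤ dist z q
      · rw [ψ.zero_of_le_dist hz]
        have : 0 ≤ Real.exp (2 * gaussWeight τ k q z) * (‖V₁ z‖ ^ 2 + ‖V₂ z‖ ^ 2) := by positivity
        simpa using this
      · rw [not_le] at hz
        have h1 := le_gaussWeight (q := q) hτ hk0.le hz.le
        have h2 : Real.exp (2 * (τ * α)) ≤ Real.exp (2 * gaussWeight τ k q z) := by
          apply Real.exp_le_exp.2; linarith
        apply mul_le_mul h2 _ (hSnn z) (by positivity)
        exact mul_le_of_le_one_left (by positivity) ψ.le_one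
    -- Adding the estimates for `V₁` and `V₂` puts `4 C² (I₁ + I₂)` on the right. The lower bound on
    -- `τ` lets the left side absorb it and keep one copy of `I₁ + I₂`.
    have hcoef : 4 * C ^ 2 + 1 ≤ 4 * k * (τ * Real.exp (-k * c ^ 2)) := by
      rw [div_le_iff₀ (by positivity)] at hτ0
      linarith
    have hsum : I₁ + I₂ ≤ 2 * B * vol * Real.exp (2 * (τ * β)) := by
      have := mul_le_mul_of_nonneg_right hcoef (add_nonneg hI₁0 hI₂0)
      nlinarith
    have hfin := hlow.trans hsum
    have e : Real.exp (-(2 * (α - β)) * τ) = Real.exp (2 * (τ * β)) / Real.exp (2 * (τ * α)) := by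
      rw [← Real.exp_sub]; congr 1; ring
    rw [e, ← mul_div_assoc, le_div_iff₀ (Real.exp_pos _)]
    linarith
  have hlim : Filter.Tendsto (fun τ : ℝ => 2 * B * vol * Real.exp (-(2 * (α - β)) * τ))
      Filter.atTop (nhds 0) := by
    have h1 : Filter.Tendsto (fun τ : ℝ => -(2 * (α - β)) * τ) Filter.atTop Filter.atBot :=
      Filter.tendsto_id.const_mul_atTop_of_neg (by linarith)
    simpa using (Real.tendsto_exp_atBot.comp h1).const_mul (2 * B * vol)
  -- Since `β < α`, the bound decays exponentially as `τ → ∞`, whereas the integral of `S` does not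
  -- depend on `τ`.
  have hS0 : ∫ z, S z ≤ 0 :=
    ge_of_tendsto hlim (Filter.eventually_atTop.2 ⟨_, main⟩)
  have hSp : S p = 0 := by
    by_contra hne
    have := hScont.integral_pos_of_hasCompactSupport_nonneg_nonzero (μ := volume) hScpt hSnn hne
    linarith
  have hψ : ψ p = 1 := ψ.one_of_mem_closedBall (by simpa [ψ] using hpd.le)
  have hχ : χ p = 1 := χ.one_of_mem_closedBall (by simp [χ]; linarith)
  simp only [hS, hψ, hV₁def, hV₂def, hχ, one_smul, one_mul] at hSp
  have n1 := sq_nonneg ‖v₁ p‖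
  have n2 := sq_nonneg ‖v₂ p‖
  exact ⟨norm_eq_zero.1 (pow_eq_zero_iff two_ne_zero |>.1 (by linarith)),
    norm_eq_zero.1 (pow_eq_zero_iff two_ne_zero |>.1 (by linarith))⟩

end UniqueContinuation

/-! ### Tangent and normal plane of a conformal map at a point -/

section NormalPlane

variable {N R t : ℍ[ℝ]}

theorem inner_mul_right {K : ℍ[ℝ]} (hK : K * K = -1) (a b : ℍ[ℝ]) :
    ⟪a * K, b⟫ = -⟪a, b * K⟫ := by
  have hs := star_of_sq_neg_one hK
  rw [Quaternion.inner_def, Quaternion.inner_def, star_mul, hs]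
  simp [mul_assoc]

/-- The quaternion `n - N n R` is twice the normal part of `n`. -/
theorem starProjection_orthogonal_eq (hN : N * N = -1) (hR : R * R = -1) (ht : t ≠ 0)
    (htR : N * t = -(t * R)) (L : ℂ →L[ℝ] ℍ[ℝ]) (h1 : L 1 = t) (hI : L Complex.I = N * t)
    (n : ℍ[ℝ]) :
    (LinearMap.range L.toLinearMap)ᗮ.starProjection n = (1 / 2 : ℝ) • (n - N * n * R) := by
  have hL : ∀ X : ℂ, L X = X.re • t + X.im • (N * t) := by
    intro X
    have : X = X.re • (1 : ℂ) + X.im • Complex.I := by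
      apply Complex.ext <;> simp
    conv_lhs => rw [this]
    rw [map_add, map_smul, map_smul, h1, hI]
  have hNN : ∀ x : ℍ[ℝ], N * (N * x) = -x := fun x => by rw [← mul_assoc, hN, neg_one_mul]
  have hRR : ∀ x : ℍ[ℝ], x * R * R = -x := fun x => by rw [mul_assoc, hR, mul_neg_one]
  have htan : N * t * R = t := by rw [htR, neg_mul, hRR, neg_neg]
  have hfix : ∀ X, N * L X * R = L X := by
    intro X
    rw [hL, mul_add, mul_smul_comm, mul_smul_comm, add_mul, smul_mul_assoc, smul_mul_assoc, htan,
      mul_assoc N (N * t) R, htan]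
  refine Submodule.eq_starProjection_of_mem_of_inner_eq_zero ?_ ?_
  · rw [Submodule.mem_orthogonal]
    rintro _ ⟨X, rfl⟩
    have : ⟪L X, N * n * R⟫ = ⟪L X, n⟫ := by
      conv_rhs => rw [← hfix X]
      rw [inner_mul_right hR, inner_mul_left hN, mul_assoc, neg_neg]
    change ⟪L X, _⟫ = 0
    rw [real_inner_smul_right, inner_sub_right, this, sub_self, mul_zero]
  · intro w hw
    rw [Submodule.mem_orthogonal] at hw
    -- Dividing by `t` turns the eigenvalue equation for `n + N n R` into commutation with `N`. The
    -- quotient therefore lies in `ℝ + ℝ N`, and the vector itself is tangent.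
    have hcomm : (n + N * n * R) * t⁻¹ * N = N * ((n + N * n * R) * t⁻¹) := by
      have e1 : N * (n + N * n * R) = -((n + N * n * R) * R) := by
        rw [mul_add, add_mul, hRR, mul_assoc N n R, hNN]; abel
      have e2 : t⁻¹ * N = -(R * t⁻¹) := by
        have : t⁻¹ * (N * t) * t⁻¹ = t⁻¹ * (-(t * R)) * t⁻¹ := by rw [htR]
        simpa [mul_assoc, ht] using this
      rw [mul_assoc, e2, ← mul_assoc, e1]
      simp [mul_assoc]
    obtain ⟨α, β, h⟩ := exists_eq_add_smul_of_commute hN hcomm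
    have hmem : n + N * n * R = L (α + β * Complex.I) := by
      have h2 : n + N * n * R = ((α : ℍ[ℝ]) + β • N) * t := by
        rw [← h, inv_mul_cancel_right₀ ht]
      rw [h2, hL]
      simp [add_mul, Quaternion.coe_mul_eq_smul]
    have e : n - (1 / 2 : ℝ) • (n - N * n * R) = (1 / 2 : ℝ) • (n + N * n * R) := by
      module
    rw [e, real_inner_smul_left, hmem]
    have := hw (L (α + β * Complex.I)) ⟨_, rfl⟩
    rw [this, mul_zero]

/-- The normal plane is the `-1` eigenspace of `n ↦ N n R`. -/
theorem mem_orthogonal_range_iff (hN : N * N = -1) (hR : R * R = -1) (ht : t ≠ 0)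
    (htR : N * t = -(t * R)) (L : ℂ →L[ℝ] ℍ[ℝ]) (h1 : L 1 = t) (hI : L Complex.I = N * t)
    (n : ℍ[ℝ]) : n ∈ (LinearMap.range L.toLinearMap)ᗮ ↔ N * n = n * R := by
  rw [← Submodule.starProjection_eq_self_iff, starProjection_orthogonal_eq hN hR ht htR L h1 hI]
  have hRR : ∀ x : ℍ[ℝ], x * R * R = -x := fun x => by rw [mul_assoc, hR, mul_neg_one]
  constructor
  · intro h
    have h2 : N * n * R = -n := by
      have : (2 : ℝ) • ((1 / 2 : ℝ) • (n - N * n * R)) = (2 : ℝ) • n := by rw [h]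
      rw [smul_smul] at this
      norm_num at this
      rw [two_smul] at this
      have h3 : N * n * R = n - (n - N * n * R) := by abel
      rw [h3, this]; abel
    have h3 := congrArg (· * R) h2
    simp only [hRR, neg_mul] at h3
    exact neg_injective h3
  · intro h
    rw [h, hRR]
    module

/-- Left multiplication by `N` makes the normal plane a complex line: the quotient of two normal
vectors commutes with `N`. -/
theorem exists_of_normal (hN : N * N = -1) {u y : ℍ[ℝ]} (hu : u ≠ 0) (huN : N * u = u * R)
    (hyN : N * y = y * R) : ∃ α β : ℝ, y = α • u + β • (N * u) := by
  have hcomm : y * u⁻¹ * N = N * (y * u⁻¹) := by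
    have e2 : u⁻¹ * N = R * u⁻¹ := by
      have : u⁻¹ * (N * u) * u⁻¹ = u⁻¹ * (u * R) * u⁻¹ := by rw [huN]
      simpa [mul_assoc, hu] using this
    rw [mul_assoc, e2, ← mul_assoc, ← hyN, mul_assoc]
  obtain ⟨α, β, h⟩ := exists_eq_add_smul_of_commute hN hcomm
  refine ⟨α, β, ?_⟩
  have h2 : y = ((α : ℍ[ℝ]) + β • N) * u := by
    rw [← h, mul_assoc, inv_mul_cancel₀ hu, mul_one]
  rw [h2]
  simp [add_mul, Quaternion.coe_mul_eq_smul]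

theorem norm_smul_add_smul_sq (hN : N * N = -1) (u : ℍ[ℝ]) (α β : ℝ) :
    ‖α • u + β • (N * u)‖ ^ 2 = (α ^ 2 + β ^ 2) * ‖u‖ ^ 2 := by
  rw [@norm_add_sq_real, real_inner_smul_left, real_inner_smul_right, inner_mul_left_self hN,
    norm_smul, norm_smul, norm_mul, norm_of_sq_neg_one hN, mul_pow, mul_pow, Real.norm_eq_abs,
    Real.norm_eq_abs, sq_abs, sq_abs]
  ring

/-- An ellipse that lies on a sphere has orthogonal conjugate half-axes of equal length. -/
theorem inner_eq_zero_of_norm_const {V : Type*} [NormedAddCommGroup V] [InnerProductSpace ℝ V]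
    {d u v : V} {r : ℝ} (h : ∀ θ : ℝ, ‖d + (Real.cos θ • u + Real.sin θ • v)‖ = r) :
    ‖u‖ = ‖v‖ ∧ ⟪u, v⟫ = 0 := by
  have h' : ∀ θ : ℝ, ‖d‖ ^ 2 + 2 * (Real.cos θ * ⟪d, u⟫ + Real.sin θ * ⟪d, v⟫)
      + (Real.cos θ ^ 2 * ‖u‖ ^ 2 + 2 * (Real.cos θ * Real.sin θ * ⟪u, v⟫)
        + Real.sin θ ^ 2 * ‖v‖ ^ 2) = r ^ 2 := by
    intro θ
    rw [← h θ, norm_add_sq_real d, norm_add_sq_real (Real.cos θ • u),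
      inner_add_right]
    simp only [real_inner_smul_left, real_inner_smul_right, norm_smul, mul_pow, Real.norm_eq_abs,
      sq_abs]
    ring
  -- Opposite angles cancel the linear terms, the quarter turns compare the lengths, and `π / 4`
  -- isolates the mixed term.
  have h0 := h' 0
  have hπ := h' Real.pi
  have hp := h' (Real.pi / 2)
  have hm := h' (-(Real.pi / 2))
  have hq := h' (Real.pi / 4)
  have hs : (√2 / 2) ^ 2 = (1 / 2 : ℝ) := by
    rw [div_pow, Real.sq_sqrt (by norm_num)]; norm_num
  simp only [Real.cos_zero, Real.sin_zero] at h0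
  simp only [Real.cos_pi, Real.sin_pi] at hπ
  simp only [Real.cos_pi_div_two, Real.sin_pi_div_two] at hp
  simp only [Real.cos_neg, Real.sin_neg, Real.cos_pi_div_two, Real.sin_pi_div_two] at hm
  simp only [Real.cos_pi_div_four, Real.sin_pi_div_four, ← sq, hs] at hq
  have e1 : ⟪d, u⟫ = 0 := by linarith
  have e2 : ⟪d, v⟫ = 0 := by linarith
  have e3 : ‖u‖ ^ 2 = ‖v‖ ^ 2 := by linarith
  rw [e1, e2] at hq
  refine ⟨?_, by linarith⟩
  exact (sq_eq_sq₀ (norm_nonneg _) (norm_nonneg _)).1 e3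

theorem exists_cos_sin {α β : ℝ} (h : α ^ 2 + β ^ 2 = 1) :
    ∃ θ : ℝ, α = Real.cos θ ∧ β = Real.sin θ := by
  have hn : ‖(⟨α, β⟩ : ℂ)‖ = 1 := by
    have : ‖(⟨α, β⟩ : ℂ)‖ ^ 2 = 1 := by
      rw [Complex.sq_norm, Complex.normSq_apply]; simp; linarith
    nlinarith [norm_nonneg (⟨α, β⟩ : ℂ)]
  obtain ⟨θ, hθ⟩ := (Complex.norm_eq_one_iff _).1 hn
  refine ⟨θ, ?_, ?_⟩
  · have := congrArg Complex.re hθ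
    rw [Complex.exp_ofReal_mul_I_re] at this; exact this.symm
  · have := congrArg Complex.im hθ
    rw [Complex.exp_ofReal_mul_I_im] at this; exact this.symm

/-- In the normal plane, the ellipse `m + cos θ u + sin θ v` is a circle if and only if
`v = ± N u`. -/
theorem ellipse_eq_circle_iff (hN : N * N = -1) {m u v : ℍ[ℝ]} (hm : N * m = m * R)
    (hu : N * u = u * R) (hv : N * v = v * R) :
    (∃ c, N * c = c * R ∧ ∃ r : ℝ, 0 ≤ r ∧
        {x | ∃ θ : ℝ, x = m + (Real.cos θ • u + Real.sin θ • v)}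
          = {x | N * x = x * R ∧ ‖x - c‖ = r})
      ↔ v = N * u ∨ v = -(N * u) := by
  constructor
  · rintro ⟨c, -, r, -, hE⟩
    have h : ∀ θ : ℝ, ‖(m - c) + (Real.cos θ • u + Real.sin θ • v)‖ = r := by
      intro θ
      have : m + (Real.cos θ • u + Real.sin θ • v) ∈
          {x | ∃ θ : ℝ, x = m + (Real.cos θ • u + Real.sin θ • v)} := ⟨θ, rfl⟩
      rw [hE] at this
      rw [← this.2]; congr 1; abel
    obtain ⟨h1, h2⟩ := inner_eq_zero_of_norm_const h
    -- The umbilic case: equal lengths force `v = 0` as well, and both signs hold.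
    by_cases hu0 : u = 0
    · left
      rw [hu0, norm_zero] at h1
      rw [hu0, mul_zero, norm_eq_zero.1 h1.symm]
    obtain ⟨α, β, hαβ⟩ := exists_of_normal hN hu0 hu hv
    have hn : ‖u‖ ^ 2 ≠ 0 := pow_ne_zero _ (norm_ne_zero_iff.2 hu0)
    have hα : α = 0 := by
      rw [hαβ, inner_add_right, real_inner_smul_right, real_inner_smul_right,
        inner_mul_left_self hN, real_inner_self_eq_norm_sq] at h2
      have : α * ‖u‖ ^ 2 = 0 := by linarith
      exact (mul_eq_zero.1 this).resolve_right hn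
    have hβ : β ^ 2 = 1 := by
      have h3 := norm_smul_add_smul_sq hN u α β
      rw [← hαβ, ← h1, hα] at h3
      have : (β ^ 2 - 1) * ‖u‖ ^ 2 = 0 := by linarith
      have := (mul_eq_zero.1 this).resolve_right hn
      linarith
    rw [hα] at hαβ
    rcases sq_eq_one_iff.1 hβ with h | h
    · left; rw [hαβ, h]; simp
    · right; rw [hαβ, h]; simp
  · intro h
    obtain ⟨ε, hε, hv'⟩ : ∃ ε : ℝ, ε ^ 2 = 1 ∧ v = ε • (N * u) := by
      rcases h with h | h
      · exact ⟨1, by norm_num, by simpa using h⟩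
      · exact ⟨-1, by norm_num, by simpa using h⟩
    refine ⟨m, hm, ‖u‖, norm_nonneg _, ?_⟩
    ext x
    constructor
    · rintro ⟨θ, rfl⟩
      constructor
      · rw [mul_add, mul_add, mul_smul_comm, mul_smul_comm, hm, hu, hv, add_mul, add_mul,
          smul_mul_assoc, smul_mul_assoc]
      · rw [add_sub_cancel_left, hv', smul_smul, ← sq_eq_sq₀ (norm_nonneg _) (norm_nonneg _),
          norm_smul_add_smul_sq hN, mul_pow, hε, mul_one, Real.cos_sq_add_sin_sq, one_mul]
    · rintro ⟨hx, hxr⟩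
      by_cases hu0 : u = 0
      · refine ⟨0, ?_⟩
        rw [hu0, norm_zero, norm_eq_zero, sub_eq_zero] at hxr
        simp [hxr, hu0]
      obtain ⟨α, β, hαβ⟩ := exists_of_normal hN hu0 hu
        (y := x - m) (by rw [mul_sub, sub_mul, hx, hm])
      have hn : ‖u‖ ^ 2 ≠ 0 := pow_ne_zero _ (norm_ne_zero_iff.2 hu0)
      have h3 := norm_smul_add_smul_sq hN u α β
      rw [← hαβ, hxr] at h3
      have h4 : α ^ 2 + β ^ 2 = 1 := by
        have : (α ^ 2 + β ^ 2 - 1) * ‖u‖ ^ 2 = 0 := by linarith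
        have := (mul_eq_zero.1 this).resolve_right hn
        linarith
      -- The sign `ε` is the orientation in which the ellipse runs around the circle, so the angle
      -- has to be reflected when `ε = -1`.
      obtain ⟨θ, h5, h6⟩ := exists_cos_sin (α := α) (β := ε * β) (by
        rw [mul_pow, hε, one_mul, h4])
      refine ⟨θ, ?_⟩
      rw [← h5, ← h6, hv', smul_smul]
      have : ε * β * ε = β := by
        have : ε * β * ε = ε ^ 2 * β := by ring
        rw [this, hε, one_mul]
      rw [this, ← hαβ]; abel

/-- Since `1` and `i` map to orthogonal vectors of length `‖t‖`, unit tangent vectors are `(cos θ,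
sin θ) / ‖t‖`. A quadratic form on this circle depends on the doubled angle, so its centre and
half-axes come from `a + c`, `a - c` and `b`. -/
theorem exists_unit_tangent_iff (hN : N * N = -1) (ht : t ≠ 0) (L : ℂ →L[ℝ] ℍ[ℝ]) (h1 : L 1 = t)
    (hI : L Complex.I = N * t) (P : ℍ[ℝ] →L[ℝ] ℍ[ℝ]) (a b c x : ℍ[ℝ]) :
    (∃ X : ℂ, ‖L X‖ = 1 ∧ x = P (X.re ^ 2 • a + (2 * X.re * X.im) • b + X.im ^ 2 • c)) ↔
      ∃ θ : ℝ, x = P (((‖t‖ ^ 2)⁻¹ / 2) • (a + c)) +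
        (Real.cos θ • P (((‖t‖ ^ 2)⁻¹ / 2) • (a - c)) + Real.sin θ • P ((‖t‖ ^ 2)⁻¹ • b)) := by
  have hL : ∀ X : ℂ, ‖L X‖ ^ 2 = (X.re ^ 2 + X.im ^ 2) * ‖t‖ ^ 2 := by
    intro X
    have : X = X.re • (1 : ℂ) + X.im • Complex.I := by
      apply Complex.ext <;> simp
    conv_lhs => rw [this]
    rw [map_add, map_smul, map_smul, h1, hI, norm_smul_add_smul_sq hN]
  have hn : 0 < ‖t‖ := norm_pos_iff.2 ht
  have hP : ∀ (α β : ℝ), α ^ 2 + β ^ 2 = 1 →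
      P ((α / ‖t‖) ^ 2 • a + (2 * (α / ‖t‖) * (β / ‖t‖)) • b + (β / ‖t‖) ^ 2 • c)
        = P (((‖t‖ ^ 2)⁻¹ / 2) • (a + c)) + ((α ^ 2 - β ^ 2) • P (((‖t‖ ^ 2)⁻¹ / 2) • (a - c))
          + (2 * α * β) • P ((‖t‖ ^ 2)⁻¹ • b)) := by
    intro α β hαβ
    rw [← map_smul, ← map_smul, ← map_add, ← map_add]
    congr 1
    have e1 : (α / ‖t‖) ^ 2 = (‖t‖ ^ 2)⁻¹ / 2 * (1 + (α ^ 2 - β ^ 2)) := by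
      rw [← hαβ]; field_simp; ring
    have e2 : (β / ‖t‖) ^ 2 = (‖t‖ ^ 2)⁻¹ / 2 * (1 - (α ^ 2 - β ^ 2)) := by
      rw [← hαβ]; field_simp; ring
    have e3 : 2 * (α / ‖t‖) * (β / ‖t‖) = 2 * α * β * (‖t‖ ^ 2)⁻¹ := by
      field_simp
    rw [e1, e2, e3]
    module
  constructor
  · rintro ⟨X, hX, rfl⟩
    have h2 : (X.re * ‖t‖) ^ 2 + (X.im * ‖t‖) ^ 2 = 1 := by
      have := hL X
      rw [hX] at this
      linarith
    obtain ⟨θ, hc, hs⟩ := exists_cos_sin h2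
    refine ⟨2 * θ, ?_⟩
    have := hP _ _ h2
    rw [mul_div_cancel_right₀ _ hn.ne', mul_div_cancel_right₀ _ hn.ne'] at this
    rw [this, hc, hs, Real.cos_two_mul', Real.sin_two_mul]
    congr 3; ring
  · rintro ⟨θ, rfl⟩
    refine ⟨⟨Real.cos (θ / 2) / ‖t‖, Real.sin (θ / 2) / ‖t‖⟩, ?_, ?_⟩
    · rw [← sq_eq_sq₀ (norm_nonneg _) zero_le_one, hL]
      have := Real.cos_sq_add_sin_sq (θ / 2)
      simp only [div_pow]
      field_simp
      linarith
    · have h2 := hP _ _ (Real.cos_sq_add_sin_sq (θ / 2))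
      rw [← Real.cos_two_mul', mul_assoc 2 (Real.cos (θ / 2))] at h2
      have e : 2 * (Real.cos (θ / 2) * Real.sin (θ / 2)) = Real.sin θ := by
        have := Real.sin_two_mul (θ / 2)
        rw [mul_div_cancel₀ θ two_ne_zero] at this
        linarith
      have e' : 2 * (θ / 2) = θ := by ring
      rw [e, e'] at h2
      exact h2.symm

/-- The curvature ellipse built from the second derivatives `a`, `b`, `c` is a circle if and only
if its conjugate half-axes are exchanged by `± N`. -/
theorem curvature_circle_iff (hN : N * N = -1) (hR : R * R = -1) (ht : t ≠ 0)
    (htR : N * t = -(t * R)) (L : ℂ →L[ℝ] ℍ[ℝ]) (h1 : L 1 = t) (hI : L Complex.I = N * t)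
    (a b c : ℍ[ℝ]) :
    (∃ x₀ ∈ (LinearMap.range L.toLinearMap)ᗮ, ∃ r : ℝ, 0 ≤ r ∧
        {x | ∃ X : ℂ, ‖L X‖ = 1 ∧ x = (LinearMap.range L.toLinearMap)ᗮ.starProjection
          (X.re ^ 2 • a + (2 * X.re * X.im) • b + X.im ^ 2 • c)}
          = {x | x ∈ (LinearMap.range L.toLinearMap)ᗮ ∧ ‖x - x₀‖ = r})
      ↔ 2 * (b - N * b * R) - N * ((a - c) - N * (a - c) * R) = 0 ∨
        2 * (b - N * b * R) + N * ((a - c) - N * (a - c) * R) = 0 := by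
  set P := (LinearMap.range L.toLinearMap)ᗮ.starProjection with hPdef
  have hP : ∀ n, P n = (1 / 2 : ℝ) • (n - N * n * R) :=
    starProjection_orthogonal_eq hN hR ht htR L h1 hI
  have hmem := mem_orthogonal_range_iff hN hR ht htR L h1 hI
  have hPm : ∀ n, N * P n = P n * R := fun n =>
    (hmem _).1 (Submodule.starProjection_apply_mem _ _)
  simp_rw [exists_unit_tangent_iff hN ht L h1 hI P a b c, hmem]
  rw [ellipse_eq_circle_iff hN (hPm _) (hPm _) (hPm _)]
  have hn : (‖t‖ ^ 2)⁻¹ ≠ 0 := inv_ne_zero (pow_ne_zero _ (norm_ne_zero_iff.2 ht))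
  rw [map_smul, map_smul, hP, hP, ← sub_eq_zero, ← sub_eq_zero (b := -_)]
  have e1 : (‖t‖ ^ 2)⁻¹ • (1 / 2 : ℝ) • (b - N * b * R)
      - N * (((‖t‖ ^ 2)⁻¹ / 2) • (1 / 2 : ℝ) • ((a - c) - N * (a - c) * R))
      = ((‖t‖ ^ 2)⁻¹ / 4) • (2 * (b - N * b * R) - N * ((a - c) - N * (a - c) * R)) := by
    rw [mul_smul_comm, mul_smul_comm, two_mul]; module
  have e2 : (‖t‖ ^ 2)⁻¹ • (1 / 2 : ℝ) • (b - N * b * R)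
      - -(N * (((‖t‖ ^ 2)⁻¹ / 2) • (1 / 2 : ℝ) • ((a - c) - N * (a - c) * R)))
      = ((‖t‖ ^ 2)⁻¹ / 4) • (2 * (b - N * b * R) + N * ((a - c) - N * (a - c) * R)) := by
    rw [mul_smul_comm, mul_smul_comm, two_mul]; module
  rw [e1, e2, smul_eq_zero_iff_right (by positivity), smul_eq_zero_iff_right (by positivity)]

end NormalPlane

/-! ### Conformal maps of plane domains into the quaternions -/

/-- A smooth conformal immersion `F` of the open set `Ω` of the plane, with left normal `N` and
right normal `R`. -/
structure ConformalOn (Ω : Set ℂ) (F N R : ℂ → ℍ[ℝ]) : Prop where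
  isOpen : IsOpen Ω
  smooth : ContDiffOn ℝ ∞ F Ω
  smooth_left : ContDiffOn ℝ ∞ N Ω
  smooth_right : ContDiffOn ℝ ∞ R Ω
  sq_left : ∀ z ∈ Ω, N z * N z = -1
  sq_right : ∀ z ∈ Ω, R z * R z = -1
  left : ∀ z ∈ Ω, dy F z = N z * dx F z
  right : ∀ z ∈ Ω, dy F z = -(dx F z * R z)
  dx_ne : ∀ z ∈ Ω, dx F z ≠ 0

/-- The obstruction `R_x + R R_y` to `*dR = R dR`. -/
def defect (R : ℂ → ℍ[ℝ]) (z : ℂ) : ℍ[ℝ] := dx R z + R z * dy R z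

/-- Twice the quaternionic mean curvature: `F_x H = -(N_x - N N_y)`. -/
def meanCurv (F N : ℂ → ℍ[ℝ]) (z : ℂ) : ℍ[ℝ] := -((dx F z)⁻¹ * (dx N z - N z * dy N z))

/-- The coefficient of the Hopf field that complements the defect of `R`. -/
def hopfCoeff (F N R : ℂ → ℍ[ℝ]) (z : ℂ) : ℍ[ℝ] :=
  2 * (dx (meanCurv F N) z + R z * dy (meanCurv F N) z) - meanCurv F N z * defect N z * N z

theorem defect_eq_zero_iff {R : ℂ → ℍ[ℝ]} {z : ℂ} (hR : R z * R z = -1) :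
    defect R z = 0 ↔ dy R z = R z * dx R z := by
  have hRR : ∀ x : ℍ[ℝ], R z * (R z * x) = -x := fun x => by rw [← mul_assoc, hR, neg_one_mul]
  rw [defect]
  constructor
  · intro h
    rw [eq_neg_of_add_eq_zero_left h, mul_neg, hRR, neg_neg]
  · intro h
    rw [h, hRR, add_neg_cancel]

theorem dx_mul_self_of_sq {Ω : Set ℂ} (hΩ : IsOpen Ω) {K : ℂ → ℍ[ℝ]} (hK : ContDiffOn ℝ ∞ K Ω)
    (hsq : ∀ z ∈ Ω, K z * K z = -1) {z : ℂ} (hz : z ∈ Ω) :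
    dx K z * K z = -(K z * dx K z) := by
  have hd := differentiableAt_of_contDiffOn hΩ hK hz
  have h : dx (fun z => K z * K z) z = 0 := by
    rw [dx_congr (h := fun _ => -1) (by filter_upwards [hΩ.mem_nhds hz] with y hy using hsq y hy),
      dx_const]
  rw [dx_mul hd hd, add_comm] at h
  exact eq_neg_of_add_eq_zero_left h

theorem dy_mul_self_of_sq {Ω : Set ℂ} (hΩ : IsOpen Ω) {K : ℂ → ℍ[ℝ]} (hK : ContDiffOn ℝ ∞ K Ω)
    (hsq : ∀ z ∈ Ω, K z * K z = -1) {z : ℂ} (hz : z ∈ Ω) :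
    dy K z * K z = -(K z * dy K z) := by
  have hd := differentiableAt_of_contDiffOn hΩ hK hz
  have h : dy (fun z => K z * K z) z = 0 := by
    rw [dy_congr (h := fun _ => -1) (by filter_upwards [hΩ.mem_nhds hz] with y hy using hsq y hy),
      dy_const]
  rw [dy_mul hd hd, add_comm] at h
  exact eq_neg_of_add_eq_zero_left h

theorem contDiffOn_defect {Ω : Set ℂ} (hΩ : IsOpen Ω) {R : ℂ → ℍ[ℝ]} (hR : ContDiffOn ℝ ∞ R Ω) :
    ContDiffOn ℝ ∞ (defect R) Ω :=
  (contDiffOn_dx hΩ hR).add (hR.mul (contDiffOn_dy hΩ hR))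

theorem dx_dy_comm_of_contDiffOn {F : Type*} [NormedAddCommGroup F] [NormedSpace ℝ F]
    {Ω : Set ℂ} (hΩ : IsOpen Ω) {g : ℂ → F} (hg : ContDiffOn ℝ ∞ g Ω) {z : ℂ} (hz : z ∈ Ω) :
    dx (dy g) z = dy (dx g) z :=
  dx_dy_comm ((contDiffOn_infty.1 hg 2).contDiffAt (hΩ.mem_nhds hz))

theorem norm_two_quaternion : ‖(2 : ℍ[ℝ])‖ = 2 := by
  have h : (2 : ℍ[ℝ]) = ((2 : ℝ) : ℍ[ℝ]) := by norm_cast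
  rw [h, Quaternion.norm_coe, Real.norm_eq_abs, abs_two]

theorem contDiffOn_inv_quaternion {g : ℂ → ℍ[ℝ]} {Ω : Set ℂ} (hg : ContDiffOn ℝ ∞ g Ω)
    (h0 : ∀ z ∈ Ω, g z ≠ 0) : ContDiffOn ℝ ∞ (fun z => (g z)⁻¹) Ω := by
  intro z hz
  have h1 : ContDiffAt ℝ ∞ (fun x : ℍ[ℝ] => Ring.inverse x) (g z) :=
    contDiffAt_ringInverse ℝ (Units.mk0 _ (h0 z hz))
  simp only [Ring.inverse_eq_inv'] at h1
  exact h1.comp_contDiffWithinAt z (hg z hz)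

/-! ### Noncommutative identities between first and second derivatives at a point. -/

section Algebra

variable {N R t Nx Ny Rx Ry a b c : ℍ[ℝ]}

/-- Here `a`, `b`, `c` stand for `F_xx`, `F_xy`, `F_yy`, computed from `F_y = N F_x`. The left side
is the circle condition with one sign; the terms in `a` cancel and the defect of `N` remains. -/
theorem left_defect_identity (hN : N * N = -1) (htR : t * R = -(N * t))
    (hNx : Nx * N = -(N * Nx)) (hNy : Ny * N = -(N * Ny))
    (hb : b = N * a + Nx * t) (hc : c = N * b + Ny * t) :
    2 * (b - N * b * R) - N * ((a - c) - N * (a - c) * R) = 2 * ((Nx + N * Ny) * t) := by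
  have hNN : ∀ x, N * (N * x) = -x := fun x => by rw [← mul_assoc, hN, neg_one_mul]
  have hNx' : ∀ x, Nx * (N * x) = -(N * (Nx * x)) := fun x => by
    rw [← mul_assoc, hNx, neg_mul, mul_assoc]
  have hNy' : ∀ x, Ny * (N * x) = -(N * (Ny * x)) := fun x => by
    rw [← mul_assoc, hNy, neg_mul, mul_assoc]
  subst hc hb
  simp only [two_mul, mul_add, add_mul, mul_sub, sub_mul, mul_assoc, neg_mul, mul_neg, htR,
    hNN, hNx', hNy']
  abel

/-- The same computation from `F_y = -F_x R`: the circle condition with the opposite sign leaves the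
defect of `R`. -/
theorem right_defect_identity (hN : N * N = -1) (hR : R * R = -1) (htR : N * t = -(t * R))
    (hRx : Rx * R = -(R * Rx)) (hRy : Ry * R = -(R * Ry))
    (hb : b = -(t * Rx + a * R)) (hc : c = -(t * Ry + b * R)) :
    2 * (b - N * b * R) + N * ((a - c) - N * (a - c) * R) = -(2 * (t * (Rx + R * Ry))) := by
  have hNN : ∀ x, N * (N * x) = -x := fun x => by rw [← mul_assoc, hN, neg_one_mul]
  have hRR : ∀ x, R * (R * x) = -x := fun x => by rw [← mul_assoc, hR, neg_one_mul]
  have ht : ∀ x, N * (t * x) = -(t * (R * x)) := fun x => by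
    rw [← mul_assoc, htR, neg_mul, mul_assoc]
  subst hc hb
  simp only [two_mul, mul_add, add_mul, mul_sub, sub_mul, mul_assoc, neg_mul, mul_neg,
    hNN, ht, hRR, hR, hRx, hRy, mul_one]
  abel

/-- Both sides come from the Laplacian `a + c`, computed once through `N` and once through `R`.
Hence the two normals share one mean curvature. -/
theorem mean_curvature_identity (hN : N * N = -1) (hR : R * R = -1) (htR : N * t = -(t * R))
    (hRx : Rx * R = -(R * Rx))
    (hb : b = N * a + Nx * t) (hc : c = N * b + Ny * t)
    (hb' : b = -(t * Rx + a * R)) (hc' : c = -(t * Ry + b * R)) :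
    (Nx - N * Ny) * t = t * (Rx - R * Ry) := by
  have hNN : ∀ x, N * (N * x) = -x := fun x => by rw [← mul_assoc, hN, neg_one_mul]
  have hRR : ∀ x, R * (R * x) = -x := fun x => by rw [← mul_assoc, hR, neg_one_mul]
  have ht : ∀ x, N * (t * x) = -(t * (R * x)) := fun x => by
    rw [← mul_assoc, htR, neg_mul, mul_assoc]
  have e1 : c + a = (N * Nx + Ny) * t := by
    rw [hc, hb]
    simp only [mul_add, add_mul, mul_assoc, hNN]
    abel
  have e2 : c + a = t * (Rx * R - Ry) := by
    rw [hc', hb']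
    simp only [add_mul, mul_sub, neg_mul, mul_assoc, hR, mul_neg, mul_one]
    abel
  have e3 : N * ((N * Nx + Ny) * t) = N * (t * (Rx * R - Ry)) := by rw [← e1, e2]
  rw [hRx] at e3
  simp only [mul_add, add_mul, mul_sub, sub_mul, mul_neg, mul_assoc, hNN, ht, hRR] at e3 ⊢
  rw [sub_eq_sub_iff_add_eq_add]
  have e4 := congrArg Neg.neg e3
  simp only [neg_add, neg_neg, sub_eq_add_neg] at e4
  rw [← sub_eq_zero] at e4 ⊢
  rw [← e4]; abel

end Algebra

/-! ### Structure and Codazzi equations of a conformal immersion. -/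

namespace ConformalOn

variable {Ω : Set ℂ} {F N R : ℂ → ℍ[ℝ]} {z : ℂ}

theorem smooth_dx (h : ConformalOn Ω F N R) : ContDiffOn ℝ ∞ (dx F) Ω :=
  contDiffOn_dx h.isOpen h.smooth

theorem smooth_dy (h : ConformalOn Ω F N R) : ContDiffOn ℝ ∞ (dy F) Ω :=
  contDiffOn_dy h.isOpen h.smooth

theorem differentiableAt (h : ConformalOn Ω F N R) {E : Type*} [NormedAddCommGroup E]
    [NormedSpace ℝ E] {g : ℂ → E} (hg : ContDiffOn ℝ ∞ g Ω) (hz : z ∈ Ω) :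
    DifferentiableAt ℝ g z := differentiableAt_of_contDiffOn h.isOpen hg hz

theorem smooth_meanCurv (h : ConformalOn Ω F N R) : ContDiffOn ℝ ∞ (meanCurv F N) Ω := by
  have hi := contDiffOn_inv_quaternion h.smooth_dx h.dx_ne
  exact (hi.mul ((contDiffOn_dx h.isOpen h.smooth_left).sub
    (h.smooth_left.mul (contDiffOn_dy h.isOpen h.smooth_left)))).neg

theorem smooth_hopfCoeff (h : ConformalOn Ω F N R) : ContDiffOn ℝ ∞ (hopfCoeff F N R) Ω :=
  (contDiffOn_const.mul ((contDiffOn_dx h.isOpen h.smooth_meanCurv).add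
    (h.smooth_right.mul (contDiffOn_dy h.isOpen h.smooth_meanCurv)))).sub
    ((h.smooth_meanCurv.mul (contDiffOn_defect h.isOpen h.smooth_left)).mul h.smooth_left)

theorem left_mul_dx (h : ConformalOn Ω F N R) (hz : z ∈ Ω) :
    N z * dx F z = -(dx F z * R z) := by rw [← h.left z hz, h.right z hz]

theorem dx_dy_left (h : ConformalOn Ω F N R) (hz : z ∈ Ω) :
    dx (dy F) z = N z * dx (dx F) z + dx N z * dx F z := by
  rw [dx_congr (h := fun z => N z * dx F z)
    (by filter_upwards [h.isOpen.mem_nhds hz] with y hy using h.left y hy),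
    dx_mul (h.differentiableAt h.smooth_left hz) (h.differentiableAt h.smooth_dx hz)]

theorem dy_dy_left (h : ConformalOn Ω F N R) (hz : z ∈ Ω) :
    dy (dy F) z = N z * dx (dy F) z + dy N z * dx F z := by
  rw [dy_congr (h := fun z => N z * dx F z)
    (by filter_upwards [h.isOpen.mem_nhds hz] with y hy using h.left y hy),
    dy_mul (h.differentiableAt h.smooth_left hz) (h.differentiableAt h.smooth_dx hz),
    dx_dy_comm_of_contDiffOn h.isOpen h.smooth hz]

theorem dx_dy_right (h : ConformalOn Ω F N R) (hz : z ∈ Ω) :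
    dx (dy F) z = -(dx F z * dx R z + dx (dx F) z * R z) := by
  rw [dx_congr (h := fun z => -(dx F z * R z))
    (by filter_upwards [h.isOpen.mem_nhds hz] with y hy using h.right y hy), dx_neg,
    dx_mul (h.differentiableAt h.smooth_dx hz) (h.differentiableAt h.smooth_right hz)]

theorem dy_dy_right (h : ConformalOn Ω F N R) (hz : z ∈ Ω) :
    dy (dy F) z = -(dx F z * dy R z + dx (dy F) z * R z) := by
  rw [dy_congr (h := fun z => -(dx F z * R z))
    (by filter_upwards [h.isOpen.mem_nhds hz] with y hy using h.right y hy), dy_neg,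
    dy_mul (h.differentiableAt h.smooth_dx hz) (h.differentiableAt h.smooth_right hz),
    dx_dy_comm_of_contDiffOn h.isOpen h.smooth hz]

theorem dx_left_anticomm (h : ConformalOn Ω F N R) (hz : z ∈ Ω) :
    dx N z * N z = -(N z * dx N z) := dx_mul_self_of_sq h.isOpen h.smooth_left h.sq_left hz

theorem dy_left_anticomm (h : ConformalOn Ω F N R) (hz : z ∈ Ω) :
    dy N z * N z = -(N z * dy N z) := dy_mul_self_of_sq h.isOpen h.smooth_left h.sq_left hz

theorem dx_right_anticomm (h : ConformalOn Ω F N R) (hz : z ∈ Ω) :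
    dx R z * R z = -(R z * dx R z) := dx_mul_self_of_sq h.isOpen h.smooth_right h.sq_right hz

theorem dy_right_anticomm (h : ConformalOn Ω F N R) (hz : z ∈ Ω) :
    dy R z * R z = -(R z * dy R z) := dy_mul_self_of_sq h.isOpen h.smooth_right h.sq_right hz

/-- The curvature ellipse at `z` is a circle if and only if one of the two normals has
vanishing defect at `z`. -/
theorem curvature_circle_iff (h : ConformalOn Ω F N R) (hz : z ∈ Ω) :
    (∃ x₀ ∈ (LinearMap.range (fderiv ℝ F z).toLinearMap)ᗮ, ∃ r : ℝ, 0 ≤ r ∧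
        {x | ∃ X : ℂ, ‖fderiv ℝ F z X‖ = 1 ∧
          x = (LinearMap.range (fderiv ℝ F z).toLinearMap)ᗮ.starProjection
            (fderiv ℝ (fun z => fderiv ℝ F z X) z X)}
          = {x | x ∈ (LinearMap.range (fderiv ℝ F z).toLinearMap)ᗮ ∧ ‖x - x₀‖ = r})
      ↔ defect R z = 0 ∨ defect N z = 0 := by
  -- Polarised form of the second derivative; symmetry of mixed partials produces the factor `2`.
  have hsnd : ∀ X : ℂ, fderiv ℝ (fun z => fderiv ℝ F z X) z X
      = X.re ^ 2 • dx (dx F) z + (2 * X.re * X.im) • dx (dy F) z + X.im ^ 2 • dy (dy F) z := by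
    intro X
    have e : (fun z => fderiv ℝ F z X) = fun z => X.re • dx F z + X.im • dy F z :=
      funext fun z => fderiv_eq_dx_dy F z X
    have d1 := h.differentiableAt h.smooth_dx hz
    have d2 := h.differentiableAt h.smooth_dy hz
    have d1' : DifferentiableAt ℝ (fun z => X.re • dx F z) z := d1.const_smul X.re
    have d2' : DifferentiableAt ℝ (fun z => X.im • dy F z) z := d2.const_smul X.im
    rw [e, fderiv_eq_dx_dy, dx_add d1' d2', dy_add d1' d2',
      dx_smul (differentiableAt_const _) d1, dx_smul (differentiableAt_const _) d2,
      dy_smul (differentiableAt_const _) d1, dy_smul (differentiableAt_const _) d2,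
      dx_const, dx_const, dy_const, dy_const, dx_dy_comm_of_contDiffOn h.isOpen h.smooth hz]
    module
  simp_rw [hsnd]
  have ht := h.dx_ne z hz
  rw [SuperConformal.curvature_circle_iff (h.sq_left z hz) (h.sq_right z hz) ht
    (h.left_mul_dx hz) (fderiv ℝ F z) rfl (h.left z hz),
    left_defect_identity (h.sq_left z hz) (neg_eq_iff_eq_neg.1 (h.left_mul_dx hz).symm)
      (h.dx_left_anticomm hz) (h.dy_left_anticomm hz) (h.dx_dy_left hz) (h.dy_dy_left hz),
    right_defect_identity (h.sq_left z hz) (h.sq_right z hz) (h.left_mul_dx hz)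
      (h.dx_right_anticomm hz) (h.dy_right_anticomm hz) (h.dx_dy_right hz) (h.dy_dy_right hz)]
  change 2 * (defect N z * dx F z) = 0 ∨ -(2 * (dx F z * defect R z)) = 0 ↔ _
  have h2 : (2 : ℍ[ℝ]) ≠ 0 := norm_ne_zero_iff.1 (by rw [norm_two_quaternion]; norm_num)
  rw [or_comm]
  simp [ht, h2]

theorem dx_mul_meanCurv (h : ConformalOn Ω F N R) (hz : z ∈ Ω) :
    dx F z * meanCurv F N z = -(dx N z - N z * dy N z) := by
  rw [meanCurv, mul_neg, mul_inv_cancel_left₀ (h.dx_ne z hz)]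

theorem meanCurv_mul_dx (h : ConformalOn Ω F N R) (hz : z ∈ Ω) :
    meanCurv F N z * dx F z = -(dx R z - R z * dy R z) := by
  rw [meanCurv, neg_mul, mul_assoc,
    mean_curvature_identity (h.sq_left z hz) (h.sq_right z hz) (h.left_mul_dx hz)
      (h.dx_right_anticomm hz) (h.dx_dy_left hz) (h.dy_dy_left hz) (h.dx_dy_right hz)
      (h.dy_dy_right hz), inv_mul_cancel_left₀ (h.dx_ne z hz)]

theorem right_mul_meanCurv (h : ConformalOn Ω F N R) (hz : z ∈ Ω) :
    R z * meanCurv F N z = meanCurv F N z * N z := by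
  apply mul_right_cancel₀ (h.dx_ne z hz)
  rw [mul_assoc, mul_assoc, h.left_mul_dx hz, mul_neg, ← mul_assoc (meanCurv F N z) (dx F z),
    h.meanCurv_mul_dx hz]
  have hRR : ∀ x, R z * (R z * x) = -x := fun x => by
    rw [← mul_assoc, h.sq_right z hz, neg_one_mul]
  simp only [mul_neg, neg_mul, mul_sub, sub_mul, mul_assoc, h.dx_right_anticomm hz,
    h.dy_right_anticomm hz, hRR]
  abel

/-- This and the next three lemmas split `dN` and `dR` into a defect part and a mean-curvature part.
Equality of mixed partials of these expressions yields the Codazzi equations. -/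
theorem two_dx_left (h : ConformalOn Ω F N R) (hz : z ∈ Ω) :
    2 * dx N z = defect N z - dx F z * meanCurv F N z := by
  rw [h.dx_mul_meanCurv hz, defect, two_mul]; abel

theorem two_dy_left (h : ConformalOn Ω F N R) (hz : z ∈ Ω) :
    2 * dy N z = -(N z * defect N z) - dy F z * meanCurv F N z := by
  have hNN : ∀ x, N z * (N z * x) = -x := fun x => by
    rw [← mul_assoc, h.sq_left z hz, neg_one_mul]
  rw [h.left z hz, mul_assoc, h.dx_mul_meanCurv hz, defect, two_mul]
  simp only [mul_add, mul_neg, mul_sub, hNN]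
  abel

theorem two_dx_right (h : ConformalOn Ω F N R) (hz : z ∈ Ω) :
    2 * dx R z = defect R z - meanCurv F N z * dx F z := by
  rw [h.meanCurv_mul_dx hz, defect, two_mul]; abel

theorem two_dy_right (h : ConformalOn Ω F N R) (hz : z ∈ Ω) :
    2 * dy R z = -(R z * defect R z) - meanCurv F N z * dy F z := by
  have hRR : ∀ x, R z * (R z * x) = -x := fun x => by
    rw [← mul_assoc, h.sq_right z hz, neg_one_mul]
  rw [h.left z hz, ← mul_assoc, ← h.right_mul_meanCurv hz, mul_assoc, h.meanCurv_mul_dx hz,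
    defect, two_mul]
  simp only [mul_add, mul_neg, mul_sub, hRR]
  abel

/-- Compatibility `R_xy = R_yx` of the splitting of `dR`; the terms with `F_xy` cancel. The equation
is not closed in the defect, because derivatives of the mean curvature remain. -/
theorem cauchyRiemann_defect_aux (h : ConformalOn Ω F N R) (hz : z ∈ Ω) :
    dy (defect R) z + R z * dx (defect R) z = -(dx R z * defect R z)
      + dy (meanCurv F N) z * dx F z - dx (meanCurv F N) z * dy F z := by
  have hD := contDiffOn_defect h.isOpen h.smooth_right
  have d := fun {g : ℂ → ℍ[ℝ]} (hg : ContDiffOn ℝ ∞ g Ω) => h.differentiableAt hg hz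
  have e1 : dy (fun z => 2 * dx R z) z
      = dy (fun z => defect R z - meanCurv F N z * dx F z) z :=
    dy_congr (by filter_upwards [h.isOpen.mem_nhds hz] with y hy using h.two_dx_right hy)
  have e2 : dx (fun z => 2 * dy R z) z
      = dx (fun z => -(R z * defect R z) - meanCurv F N z * dy F z) z :=
    dx_congr (by filter_upwards [h.isOpen.mem_nhds hz] with y hy using h.two_dy_right hy)
  rw [dy_mul (d contDiffOn_const) (d (contDiffOn_dx h.isOpen h.smooth_right)), dy_const, zero_mul,
    add_zero, dy_sub (d hD) (d (h.smooth_meanCurv.mul h.smooth_dx)),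
    dy_mul (d h.smooth_meanCurv) (d h.smooth_dx)] at e1
  rw [dx_mul (d contDiffOn_const) (d (contDiffOn_dy h.isOpen h.smooth_right)), dx_const, zero_mul,
    add_zero, dx_sub (d (h.smooth_right.mul hD).neg) (d (h.smooth_meanCurv.mul h.smooth_dy)),
    dx_neg, dx_mul (d h.smooth_right) (d hD), dx_mul (d h.smooth_meanCurv) (d h.smooth_dy),
    dx_dy_comm_of_contDiffOn h.isOpen h.smooth_right hz,
    dx_dy_comm_of_contDiffOn h.isOpen h.smooth hz, e1] at e2
  rw [← sub_eq_zero] at e2 ⊢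
  rw [← e2]; abel

/-- Compatibility `N_xy = N_yx`: with no defect of `N` it reduces to `F_x H_y = F_y H_x`, where `H`
is the mean curvature, and `F_y = -F_x R`. -/
theorem dy_meanCurv_of_left (h : ConformalOn Ω F N R) (hz : z ∈ Ω)
    (hσ : defect N =ᶠ[nhds z] 0) :
    dy (meanCurv F N) z = -(R z * dx (meanCurv F N) z) := by
  have d := fun {g : ℂ → ℍ[ℝ]} (hg : ContDiffOn ℝ ∞ g Ω) => h.differentiableAt hg hz
  have e1 : dy (fun z => 2 * dx N z) z = dy (fun z => -(dx F z * meanCurv F N z)) z :=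
    dy_congr (by
      filter_upwards [h.isOpen.mem_nhds hz, hσ] with y hy hy'
      rw [h.two_dx_left hy, hy', Pi.zero_apply, zero_sub])
  have e2 : dx (fun z => 2 * dy N z) z = dx (fun z => -(dy F z * meanCurv F N z)) z :=
    dx_congr (by
      filter_upwards [h.isOpen.mem_nhds hz, hσ] with y hy hy'
      rw [h.two_dy_left hy, hy', Pi.zero_apply, mul_zero, neg_zero, zero_sub])
  rw [dy_mul (d contDiffOn_const) (d (contDiffOn_dx h.isOpen h.smooth_left)), dy_const, zero_mul,
    add_zero, dy_neg, dy_mul (d h.smooth_dx) (d h.smooth_meanCurv)] at e1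
  rw [dx_mul (d contDiffOn_const) (d (contDiffOn_dy h.isOpen h.smooth_left)), dx_const, zero_mul,
    add_zero, dx_neg, dx_mul (d h.smooth_dy) (d h.smooth_meanCurv),
    dx_dy_comm_of_contDiffOn h.isOpen h.smooth_left hz,
    dx_dy_comm_of_contDiffOn h.isOpen h.smooth hz, e1, neg_inj, add_left_inj, h.right z hz] at e2
  apply mul_left_cancel₀ (h.dx_ne z hz)
  rw [e2]
  simp [mul_assoc]

/-- The second unknown of the system should be `H_x` where the defect of `N` vanishes, and zero
where the defect of `R` vanishes. `hopfCoeff` is one smooth expression that does both, up to the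
factor `4`. -/
theorem hopfCoeff_of_left (h : ConformalOn Ω F N R) (hz : z ∈ Ω)
    (hσ : defect N =ᶠ[nhds z] 0) : hopfCoeff F N R z = 4 * dx (meanCurv F N) z := by
  have hRR : ∀ x, R z * (R z * x) = -x := fun x => by
    rw [← mul_assoc, h.sq_right z hz, neg_one_mul]
  have h0 : defect N z = 0 := hσ.self_of_nhds
  rw [hopfCoeff, h0, h.dy_meanCurv_of_left hz hσ, mul_neg, hRR]
  noncomm_ring

/-- With no defect of `R`, the compatibility equation gives `H_y = H_x N`. Differentiating `R H = H
N` then expresses `H_x + R H_y` through `N_x` and `R_x`, and the correction term in `hopfCoeff`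
cancels the result. -/
theorem hopfCoeff_of_right (h : ConformalOn Ω F N R) (hz : z ∈ Ω)
    (hρ : defect R =ᶠ[nhds z] 0) : hopfCoeff F N R z = 0 := by
  have d := fun {g : ℂ → ℍ[ℝ]} (hg : ContDiffOn ℝ ∞ g Ω) => h.differentiableAt hg hz
  have hNN : ∀ x, x * N z * N z = -x := fun x => by
    rw [mul_assoc, h.sq_left z hz, mul_neg_one]
  have h0 : defect R z = 0 := hρ.self_of_nhds
  have hx : dx (defect R) z = 0 := by
    rw [dx_congr (h := fun _ => 0) hρ, dx_const]
  have hy : dy (defect R) z = 0 := by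
    rw [dy_congr (h := fun _ => 0) hρ, dy_const]
  have e1 := h.cauchyRiemann_defect_aux hz
  rw [h0, hx, hy, h.left z hz, mul_zero, mul_zero, neg_zero, zero_add, zero_add, eq_comm,
    sub_eq_zero, ← mul_assoc] at e1
  have hHy := mul_right_cancel₀ (h.dx_ne z hz) e1
  have e2 : dx (fun z => R z * meanCurv F N z) z = dx (fun z => meanCurv F N z * N z) z :=
    dx_congr (by filter_upwards [h.isOpen.mem_nhds hz] with y hy using h.right_mul_meanCurv hy)
  rw [dx_mul (d h.smooth_right) (d h.smooth_meanCurv),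
    dx_mul (d h.smooth_meanCurv) (d h.smooth_left), ← eq_sub_iff_add_eq] at e2
  have e3 := h.two_dx_right hz
  rw [h0, zero_sub] at e3
  have e4 := h.two_dx_left hz
  rw [hopfCoeff, hHy, ← mul_assoc, e2]
  have e5 : defect N z = 2 * dx N z + dx F z * meanCurv F N z := by rw [e4]; abel
  have e6 : meanCurv F N z * dx F z = -(2 * dx R z) := by rw [e3, neg_neg]
  rw [e5, mul_add (meanCurv F N z), ← mul_assoc _ (dx F z), e6]
  simp only [two_mul, mul_add, add_mul, sub_mul, neg_mul, hNN]
  abel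

/-- Here `hopfCoeff` is `4 H_x`. The first equation is the compatibility of `dR`, and the second is
the `x`-derivative of `H_y = -R H_x`. -/
theorem cauchyRiemann_of_left (h : ConformalOn Ω F N R) (hz : z ∈ Ω)
    (hσ : defect N =ᶠ[nhds z] 0) :
    4 * (dy (defect R) z + R z * dx (defect R) z) = -(4 * (dx R z * defect R z)
        + R z * hopfCoeff F N R z * dx F z + hopfCoeff F N R z * N z * dx F z) ∧
      dy (hopfCoeff F N R) z + R z * dx (hopfCoeff F N R) z
        = -(dx R z * hopfCoeff F N R z) := by
  have d := fun {g : ℂ → ℍ[ℝ]} (hg : ContDiffOn ℝ ∞ g Ω) => h.differentiableAt hg hz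
  have hev : hopfCoeff F N R =ᶠ[nhds z] fun z => 4 * dx (meanCurv F N) z := by
    filter_upwards [h.isOpen.mem_nhds hz, hσ.eventuallyEq_nhds] with y hy hy'
      using h.hopfCoeff_of_left hy hy'
  have hev' : dy (meanCurv F N) =ᶠ[nhds z] fun z => -(R z * dx (meanCurv F N) z) := by
    filter_upwards [h.isOpen.mem_nhds hz, hσ.eventuallyEq_nhds] with y hy hy'
      using h.dy_meanCurv_of_left hy hy'
  have hHx := contDiffOn_dx h.isOpen h.smooth_meanCurv
  constructor
  · rw [h.cauchyRiemann_defect_aux hz, h.dy_meanCurv_of_left hz hσ, h.hopfCoeff_of_left hz hσ,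
      h.left z hz]
    noncomm_ring
  · rw [h.hopfCoeff_of_left hz hσ, dx_congr hev, dy_congr hev,
      dx_mul (d contDiffOn_const) (d hHx), dy_mul (d contDiffOn_const) (d hHx), dx_const, dy_const,
      ← dx_dy_comm_of_contDiffOn h.isOpen h.smooth_meanCurv hz, dx_congr hev', dx_neg,
      dx_mul (d h.smooth_right) (d hHx)]
    noncomm_ring

end ConformalOn

/-! ### Unique continuation for the defect of the right normal -/

/-- An equation between continuous functions on an open set holds everywhere if it holds where `g`
does not vanish and where `g` vanishes identically nearby. -/
theorem eq_of_continuousOn_of_dichotomy {E G : Type*} [TopologicalSpace E] [T2Space E] [Zero G]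
    {Ω : Set ℂ} (hΩ : IsOpen Ω) {g : ℂ → G} {l r : ℂ → E} (hl : ContinuousOn l Ω)
    (hr : ContinuousOn r Ω) (h0 : ∀ z ∈ Ω, g =ᶠ[nhds z] 0 → l z = r z)
    (h1 : ∀ z ∈ Ω, g z ≠ 0 → l z = r z) : ∀ z ∈ Ω, l z = r z := by
  intro z hz
  by_contra hne
  have hev : ∀ᶠ y in nhds z, l y ≠ r y :=
    ((hl.continuousAt (hΩ.mem_nhds hz)).prodMk (hr.continuousAt (hΩ.mem_nhds hz))).eventually
      ((isOpen_ne_fun continuous_fst continuous_snd).mem_nhds hne)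
  refine hne (h0 z hz ?_)
  filter_upwards [hev, hΩ.mem_nhds hz] with y hy hyΩ
  by_contra hgy
  exact hy (h1 y hyΩ hgy)

namespace ConformalOn

variable {Ω : Set ℂ} {F N R : ℂ → ℍ[ℝ]} {z : ℂ}

/-- If at every point one of the two normals has vanishing defect, then the defect of the right
normal is part of a solution of a linear Cauchy-Riemann system. -/
theorem cauchyRiemann_system (h : ConformalOn Ω F N R)
    (hsc : ∀ z ∈ Ω, defect R z = 0 ∨ defect N z = 0) (hz : z ∈ Ω) :
    4 * (dy (defect R) z + R z * dx (defect R) z) = -(4 * (dx R z * defect R z)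
        + R z * hopfCoeff F N R z * dx F z + hopfCoeff F N R z * N z * dx F z) ∧
      dy (hopfCoeff F N R) z + R z * dx (hopfCoeff F N R) z
        = -(dx R z * hopfCoeff F N R z) := by
  have hD := contDiffOn_defect h.isOpen h.smooth_right
  have hW := h.smooth_hopfCoeff
  have hDx := contDiffOn_dx h.isOpen hD
  have hDy := contDiffOn_dy h.isOpen hD
  have hWx := contDiffOn_dx h.isOpen hW
  have hWy := contDiffOn_dy h.isOpen hW
  have hRx := contDiffOn_dx h.isOpen h.smooth_right
  have hR := h.smooth_right
  have hright : ∀ z ∈ Ω, defect R =ᶠ[nhds z] 0 →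
      (4 * (dy (defect R) z + R z * dx (defect R) z) = -(4 * (dx R z * defect R z)
        + R z * hopfCoeff F N R z * dx F z + hopfCoeff F N R z * N z * dx F z) ∧
      dy (hopfCoeff F N R) z + R z * dx (hopfCoeff F N R) z
        = -(dx R z * hopfCoeff F N R z)) := by
    intro z hz hρ
    have hω : hopfCoeff F N R =ᶠ[nhds z] 0 := by
      filter_upwards [h.isOpen.mem_nhds hz, hρ.eventuallyEq_nhds] with y hy hy'
        using h.hopfCoeff_of_right hy hy'
    rw [dx_congr (h := fun _ => 0) hρ, dy_congr (h := fun _ => 0) hρ,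
      dx_congr (h := fun _ => 0) hω, dy_congr (h := fun _ => 0) hω, hρ.self_of_nhds,
      hω.self_of_nhds]
    simp [dx_const, dy_const]
  have hleft : ∀ z ∈ Ω, defect R z ≠ 0 → defect N =ᶠ[nhds z] 0 := by
    intro z hz hne
    have hc := (hD.continuousOn.continuousAt (h.isOpen.mem_nhds hz)).eventually_ne hne
    filter_upwards [hc, h.isOpen.mem_nhds hz] with y hy hyΩ
    exact (hsc y hyΩ).resolve_left hy
  -- Where the defect of `R` vanishes nearby, all terms are zero. Where it is non-zero, the defect
  -- of `N` vanishes nearby. Continuity covers the boundary between the two regions.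
  constructor
  · refine eq_of_continuousOn_of_dichotomy h.isOpen (g := defect R)
      (l := fun z => 4 * (dy (defect R) z + R z * dx (defect R) z))
      (r := fun z => -(4 * (dx R z * defect R z)
        + R z * hopfCoeff F N R z * dx F z + hopfCoeff F N R z * N z * dx F z)) ?_ ?_
      (fun z hz hρ => (hright z hz hρ).1)
      (fun z hz hne => (h.cauchyRiemann_of_left hz (hleft z hz hne)).1) z hz
    · exact (contDiffOn_const.mul (hDy.add (hR.mul hDx))).continuousOn
    · exact ((((contDiffOn_const.mul (hRx.mul hD)).add ((hR.mul hW).mul h.smooth_dx)).add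
        ((hW.mul h.smooth_left).mul h.smooth_dx)).neg).continuousOn
  · refine eq_of_continuousOn_of_dichotomy h.isOpen (g := defect R)
      (l := fun z => dy (hopfCoeff F N R) z + R z * dx (hopfCoeff F N R) z)
      (r := fun z => -(dx R z * hopfCoeff F N R z)) ?_ ?_
      (fun z hz hρ => (hright z hz hρ).2)
      (fun z hz hne => (h.cauchyRiemann_of_left hz (hleft z hz hne)).2) z hz
    · exact (hWy.add (hR.mul hWx)).continuousOn
    · exact (hRx.mul hW).neg.continuousOn

/-- Unique continuation: near every point there is a disc such that the defect of the right normal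
vanishes near the centre as soon as it vanishes near some point of the disc. -/
theorem exists_ball_unique_continuation (h : ConformalOn Ω F N R)
    (hsc : ∀ z ∈ Ω, defect R z = 0 ∨ defect N z = 0) {z₀ : ℂ} (hz₀ : z₀ ∈ Ω) :
    ∃ δ > 0, ∀ q ∈ ball z₀ δ, defect R =ᶠ[nhds q] 0 → defect R =ᶠ[nhds z₀] 0 := by
  have hD := contDiffOn_defect h.isOpen h.smooth_right
  have hW := h.smooth_hopfCoeff
  have hRx := contDiffOn_dx h.isOpen h.smooth_right
  have hR := h.smooth_right
  obtain ⟨η, hη, hηΩ⟩ : ∃ η > 0, closedBall z₀ η ⊆ Ω ∩ {z | ‖R z - R z₀‖ < 1} := by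
    apply Metric.nhds_basis_closedBall.mem_iff.1
    refine Filter.inter_mem (h.isOpen.mem_nhds hz₀) ?_
    have hc := hR.continuousOn.continuousAt (h.isOpen.mem_nhds hz₀)
    have : Filter.Tendsto (fun z => ‖R z - R z₀‖) (nhds z₀) (nhds 0) := by
      have := (hc.sub (continuousAt_const (y := R z₀))).norm
      simpa [ContinuousAt] using this
    exact this.eventually_lt_const one_pos
  set R₀ := R z₀ with hR₀
  have hR₀sq : R₀ * R₀ = -1 := h.sq_right z₀ hz₀
  -- The Carleman estimate needs a constant square root of `-1`. Since `R₀ μ = μ R`, multiplying the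
  -- unknowns by `μ` changes the principal part to `∂_y + R₀ ∂_x`. The identity `μ = 2 - R₀ (R -
  -- R₀)` shows `‖μ‖ ≥ 1` on the chosen disc.
  set μ : ℂ → ℍ[ℝ] := fun z => 1 - R₀ * R z with hμdef
  have hμ : ContDiffOn ℝ ∞ μ Ω := contDiffOn_const.sub (contDiffOn_const.mul hR)
  have hμR : ∀ z ∈ Ω, R₀ * μ z = μ z * R z := by
    intro z hz
    simp only [hμdef, mul_sub, sub_mul, mul_one, one_mul, mul_assoc, h.sq_right z hz]
    rw [← mul_assoc, hR₀sq]
    simp; abel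
  have hμ1 : ∀ z ∈ closedBall z₀ η, 1 ≤ ‖μ z‖ := by
    intro z hz
    have h1 : μ z = 2 - R₀ * (R z - R₀) := by
      simp only [hμdef, mul_sub, hR₀sq, ← one_add_one_eq_two]; abel
    have h2 : ‖R₀ * (R z - R₀)‖ < 1 := by
      rw [norm_mul, norm_of_sq_neg_one hR₀sq, one_mul]; exact (hηΩ hz).2
    have h3 := norm_two_quaternion
    have h4 := norm_sub_norm_le (2 : ℍ[ℝ]) (R₀ * (R z - R₀))
    rw [h1]; linarith
  have hμx := contDiffOn_dx h.isOpen hμ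
  have hμy := contDiffOn_dy h.isOpen hμ
  obtain ⟨C, hC⟩ := (isCompact_closedBall z₀ η).bddAbove_image
    (f := fun z => ‖dy μ z + R₀ * dx μ z‖ + ‖μ z‖ * ‖dx R z‖ + ‖μ z‖ * ‖dx F z‖)
    ((((hμy.add (contDiffOn_const.mul hμx)).continuousOn.norm.add
      (hμ.continuousOn.norm.mul hRx.continuousOn.norm)).add
      (hμ.continuousOn.norm.mul h.smooth_dx.continuousOn.norm)).mono
      (fun z hz => (hηΩ hz).1))
  have hprod : ∀ (g : ℂ → ℍ[ℝ]), ContDiffOn ℝ ∞ g Ω → ∀ z ∈ Ω,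
      dy (fun z => μ z * g z) z + R₀ * dx (fun z => μ z * g z) z
        = (dy μ z + R₀ * dx μ z) * g z + μ z * (dy g z + R z * dx g z) := by
    intro g hg z hz
    rw [dx_mul (h.differentiableAt hμ hz) (h.differentiableAt hg hz),
      dy_mul (h.differentiableAt hμ hz) (h.differentiableAt hg hz), mul_add R₀, ← mul_assoc R₀,
      hμR z hz]
    noncomm_ring
  -- For `q` within `η / 3` of `z₀`, the disc of radius `2 η / 3` about `q` contains `z₀` and stays
  -- within distance `η` of it, where the coefficient bound `C` holds.
  refine ⟨η / 3, by positivity, fun q hq hρ => ?_⟩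
  have hsub : ball q (2 * η / 3) ⊆ closedBall z₀ η := by
    intro y hy
    simp only [mem_ball, mem_closedBall] at *
    have := dist_triangle y q z₀
    linarith
  have hsubΩ : ball q (2 * η / 3) ⊆ Ω := fun y hy => (hηΩ (hsub hy)).1
  have hqΩ : q ∈ Ω := hsubΩ (mem_ball_self (by positivity))
  have hω : hopfCoeff F N R =ᶠ[nhds q] 0 := by
    filter_upwards [h.isOpen.mem_nhds hqΩ, hρ.eventuallyEq_nhds] with y hy hy'
      using h.hopfCoeff_of_right hy hy'
  obtain ⟨ε, hε, hεsub⟩ := Metric.eventually_nhds_iff_ball.1 (hρ.and hω)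
  have hnn : ∀ z ∈ ball q (2 * η / 3), ‖dy μ z + R₀ * dx μ z‖ + ‖μ z‖ * ‖dx R z‖
      + ‖μ z‖ * ‖dx F z‖ ≤ C := fun z hz => hC ⟨z, hsub hz, rfl⟩
  have hle : ∀ z ∈ ball q (2 * η / 3), ∀ x : ℍ[ℝ], ‖x‖ ≤ ‖μ z * x‖ := by
    intro z hz x
    rw [norm_mul]
    exact le_mul_of_one_le_left (norm_nonneg _) (hμ1 z (hsub hz))
  have hv := eq_zero_of_cauchyRiemann_bound hR₀sq (q := q) (r := 2 * η / 3) (C := C) (ε := ε)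
    (v₁ := fun z => μ z * defect R z) (v₂ := fun z => μ z * hopfCoeff F N R z)
    ((hμ.mul hD).mono hsubΩ) ((hμ.mul hW).mono hsubΩ) ?_ ?_ hε
    (fun z hz => by simp [(hεsub z hz).1]) (fun z hz => by simp [(hεsub z hz).2])
  · have hz₀q : z₀ ∈ ball q (2 * η / 3) := by
      rw [mem_ball, dist_comm]; have := mem_ball.1 hq; linarith
    filter_upwards [isOpen_ball.mem_nhds hz₀q] with y hy
    have h1 := (hv y hy).1
    have h2 := hle y hy (defect R y)
    rw [h1, norm_zero] at h2
    exact norm_le_zero_iff.1 h2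
  · intro z hz
    have hzΩ := hsubΩ hz
    rw [hprod _ hD z hzΩ]
    have e : dy (defect R) z + R z * dx (defect R) z = -(dx R z * defect R z)
        - (1 / 4 : ℝ) • ((R z * hopfCoeff F N R z + hopfCoeff F N R z * N z) * dx F z) := by
      have e4 : ∀ x : ℍ[ℝ], 4 * x = (4 : ℝ) • x := fun x => by
        rw [← Quaternion.coe_mul_eq_smul]; norm_cast
      have := (h.cauchyRiemann_system hsc hzΩ).1
      rw [e4, e4] at this
      have h2 := congrArg (fun x => (1 / 4 : ℝ) • x) this
      simp only [smul_smul] at h2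
      norm_num at h2
      rw [h2, add_mul]
      module
    rw [e]
    have n1 : ‖R z‖ = 1 := norm_of_sq_neg_one (h.sq_right z hzΩ)
    have n2 : ‖N z‖ = 1 := norm_of_sq_neg_one (h.sq_left z hzΩ)
    have n3 : ‖R z * hopfCoeff F N R z + hopfCoeff F N R z * N z‖ ≤ 2 * ‖hopfCoeff F N R z‖ := by
      refine (norm_add_le _ _).trans ?_
      rw [norm_mul, norm_mul, n1, n2]; linarith
    have n4 : ‖-(dx R z * defect R z)
        - (1 / 4 : ℝ) • ((R z * hopfCoeff F N R z + hopfCoeff F N R z * N z) * dx F z)‖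
        ≤ ‖dx R z‖ * ‖defect R z‖ + ‖hopfCoeff F N R z‖ * ‖dx F z‖ := by
      refine (norm_sub_le _ _).trans ?_
      rw [norm_neg, norm_mul, norm_smul, norm_mul]
      have := mul_le_mul_of_nonneg_right n3 (norm_nonneg (dx F z))
      norm_num
      nlinarith [norm_nonneg (dx F z), norm_nonneg (hopfCoeff F N R z)]
    refine (norm_add_le _ _).trans ?_
    rw [norm_mul, norm_mul]
    have m1 := mul_le_mul_of_nonneg_left n4 (norm_nonneg (μ z))
    have m2 := hle z hz (defect R z)
    have m3 := hle z hz (hopfCoeff F N R z)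
    have m4 := hnn z hz
    have p1 := norm_nonneg (dy μ z + R₀ * dx μ z)
    have p2 : 0 ≤ ‖μ z‖ * ‖dx R z‖ := by positivity
    have p3 : 0 ≤ ‖μ z‖ * ‖dx F z‖ := by positivity
    have q1 := norm_nonneg (defect R z)
    have q2 := norm_nonneg (hopfCoeff F N R z)
    calc ‖dy μ z + R₀ * dx μ z‖ * ‖defect R z‖ + ‖μ z‖ * ‖-(dx R z * defect R z)
          - (1 / 4 : ℝ) • ((R z * hopfCoeff F N R z + hopfCoeff F N R z * N z) * dx F z)‖
        ≤ (‖dy μ z + R₀ * dx μ z‖ + ‖μ z‖ * ‖dx R z‖ + ‖μ z‖ * ‖dx F z‖)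
            * (‖defect R z‖ + ‖hopfCoeff F N R z‖) := by nlinarith
      _ ≤ C * (‖μ z * defect R z‖ + ‖μ z * hopfCoeff F N R z‖) := by
          apply mul_le_mul m4 (by linarith) (by positivity) (by linarith)
  · intro z hz
    have hzΩ := hsubΩ hz
    rw [hprod _ hW z hzΩ, (h.cauchyRiemann_system hsc hzΩ).2]
    refine (norm_add_le _ _).trans ?_
    rw [norm_mul, norm_mul, norm_neg, norm_mul]
    have m2 := hle z hz (defect R z)
    have m3 := hle z hz (hopfCoeff F N R z)
    have m4 := hnn z hz
    have p1 := norm_nonneg (dy μ z + R₀ * dx μ z)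
    have p2 : 0 ≤ ‖μ z‖ * ‖dx R z‖ := by positivity
    have p3 : 0 ≤ ‖μ z‖ * ‖dx F z‖ := by positivity
    have q1 := norm_nonneg (defect R z)
    have q2 := norm_nonneg (hopfCoeff F N R z)
    calc ‖dy μ z + R₀ * dx μ z‖ * ‖hopfCoeff F N R z‖
          + ‖μ z‖ * (‖dx R z‖ * ‖hopfCoeff F N R z‖)
        ≤ (‖dy μ z + R₀ * dx μ z‖ + ‖μ z‖ * ‖dx R z‖ + ‖μ z‖ * ‖dx F z‖)
            * (‖defect R z‖ + ‖hopfCoeff F N R z‖) := by nlinarith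
      _ ≤ C * (‖μ z * defect R z‖ + ‖μ z * hopfCoeff F N R z‖) := by
          apply mul_le_mul m4 (by linarith) (by positivity) (by linarith)

end ConformalOn

/-! ### Local coordinates on a Riemann surface -/

section Charts

variable {M : Type*} [TopologicalSpace M] [ChartedSpace ℂ M]

theorem contDiffOn_transition [IsManifold 𝓘(ℂ) ω M] {e e' : OpenPartialHomeomorph M ℂ}
    (he : e ∈ atlas ℂ M) (he' : e' ∈ atlas ℂ M) :
    ContDiffOn ℂ ω (e.symm ≫ₕ e') (e.symm ≫ₕ e').source :=
  (contMDiffOn_of_mem_contDiffGroupoid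
    ((contDiffGroupoid ω 𝓘(ℂ)).compatible he he')).contDiffOn

/-- The real smooth structure underlying a Riemann surface. -/
theorem isManifold_real [IsManifold 𝓘(ℂ) ω M] : IsManifold 𝓘(ℝ, ℂ) ∞ M := by
  refine isManifold_of_contDiffOn _ _ _ fun e e' he he' => ?_
  have h := ((contDiffOn_transition he he').restrict_scalars ℝ).of_le (m := ∞) le_top
  simpa using h

theorem diff_eq_fderiv {F : Type*} [NormedAddCommGroup F] [NormedSpace ℝ F] {g : M → F} {p : M}
    (hg : MDifferentiableAt 𝓘(ℝ, ℂ) 𝓘(ℝ, F) g p) :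
    diff g p = fderiv ℝ (g ∘ (chartAt ℂ p).symm) (chartAt ℂ p p) := by
  rw [diff, hg.mfderiv]
  simp only [writtenInExtChartAt, extChartAt, fderivWithin_univ, mfld_simps]
  rfl

theorem contDiffOn_comp_chart_symm [IsManifold 𝓘(ℝ, ℂ) ∞ M] {F : Type*} [NormedAddCommGroup F]
    [NormedSpace ℝ F] {g : M → F} (hg : ContMDiff 𝓘(ℝ, ℂ) 𝓘(ℝ, F) ∞ g) (p : M) :
    ContDiffOn ℝ ∞ (g ∘ (chartAt ℂ p).symm) (chartAt ℂ p).target :=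
  (hg.comp_contMDiffOn contMDiffOn_chart_symm).contDiffOn

theorem mdifferentiableAt_of_contMDiff {F : Type*} [NormedAddCommGroup F] [NormedSpace ℝ F]
    {g : M → F} (hg : ContMDiff 𝓘(ℝ, ℂ) 𝓘(ℝ, F) ∞ g) (p : M) :
    MDifferentiableAt 𝓘(ℝ, ℂ) 𝓘(ℝ, F) g p := (hg p).mdifferentiableAt (by simp)

/-- The differential in an arbitrary chart: coordinate changes act by complex multiplication. -/
theorem exists_diff_eq_fderiv_mul [IsManifold 𝓘(ℂ) ω M] (p : M) {z : ℂ}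
    (hz : z ∈ (chartAt ℂ p).target) :
    ∃ c : ℂ, c ≠ 0 ∧ ∀ g : M → ℍ[ℝ], ContMDiff 𝓘(ℝ, ℂ) 𝓘(ℝ, ℍ[ℝ]) ∞ g → ∀ X : ℂ,
      diff g ((chartAt ℂ p).symm z) X = fderiv ℝ (g ∘ (chartAt ℂ p).symm) z (c * X) := by
  have : IsManifold 𝓘(ℝ, ℂ) ∞ M := isManifold_real
  set e := chartAt ℂ p with he
  set q := e.symm z with hq
  set e' := chartAt ℂ q with he'
  have hqe : q ∈ e.source := e.map_target hz
  have hqe' : q ∈ e'.source := mem_chart_source ℂ q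
  have heq : e q = z := e.right_inv hz
  have hT : DifferentiableAt ℂ (e'.symm ≫ₕ e) (e' q) := by
    have hmem : e' q ∈ (e'.symm ≫ₕ e).source := by
      simp [hqe', hqe]
    exact ((contDiffOn_transition (chart_mem_atlas ℂ q) (chart_mem_atlas ℂ p)).contDiffAt
      ((e'.symm ≫ₕ e).open_source.mem_nhds hmem)).differentiableAt (by simp)
  have hS : DifferentiableAt ℂ (e.symm ≫ₕ e') z := by
    have hmem : z ∈ (e.symm ≫ₕ e').source := by
      simp [hz, ← hq, hqe']
    exact ((contDiffOn_transition (chart_mem_atlas ℂ p) (chart_mem_atlas ℂ q)).contDiffAt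
      ((e.symm ≫ₕ e').open_source.mem_nhds hmem)).differentiableAt (by simp)
  have hTq : (e'.symm ≫ₕ e) (e' q) = z := by
    simp [hqe', heq]
  -- The factor is the complex derivative of the transition map from the preferred chart at `q` to
  -- the chart at `p`. It is non-zero because the reverse transition map is also differentiable.
  refine ⟨deriv (e'.symm ≫ₕ e) (e' q), ?_, ?_⟩
  · intro h0
    have h1 : HasDerivAt ((e.symm ≫ₕ e') ∘ (e'.symm ≫ₕ e)) (deriv (e.symm ≫ₕ e') z * 0) (e' q) := by
      rw [← h0]
      refine HasDerivAt.comp _ ?_ hT.hasDerivAt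
      rw [hTq]; exact hS.hasDerivAt
    have hid : ((e.symm ≫ₕ e') ∘ (e'.symm ≫ₕ e)) =ᶠ[nhds (e' q)] id := by
      have hmem : e' q ∈ (e'.symm ≫ₕ e).source := by
        simp [hqe', hqe]
      filter_upwards [(e'.symm ≫ₕ e).open_source.mem_nhds hmem] with y hy
      simp only [OpenPartialHomeomorph.trans_source, OpenPartialHomeomorph.symm_source,
        Set.mem_inter_iff, Set.mem_preimage] at hy
      simp [hy.1, hy.2]
    have h2 : HasDerivAt id (deriv (e.symm ≫ₕ e') z * 0) (e' q) :=
      h1.congr_of_eventuallyEq hid.symm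
    have := h2.unique (hasDerivAt_id _)
    simp at this
  · intro g hg X
    rw [diff_eq_fderiv (mdifferentiableAt_of_contMDiff hg q)]
    have hev : g ∘ e'.symm =ᶠ[nhds (e' q)] (g ∘ e.symm) ∘ (e'.symm ≫ₕ e) := by
      have hmem : e' q ∈ (e'.symm ≫ₕ e).source := by
        simp [hqe', hqe]
      filter_upwards [(e'.symm ≫ₕ e).open_source.mem_nhds hmem] with y hy
      simp only [OpenPartialHomeomorph.trans_source, OpenPartialHomeomorph.symm_source,
        Set.mem_inter_iff, Set.mem_preimage] at hy
      simp [hy.2]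
    have hgd : DifferentiableAt ℝ (g ∘ e.symm) ((e'.symm ≫ₕ e) (e' q)) := by
      rw [hTq]
      exact differentiableAt_of_contDiffOn e.open_target (contDiffOn_comp_chart_symm hg p) hz
    rw [hev.fderiv_eq, fderiv_comp _ hgd (hT.restrictScalars ℝ), hTq,
      hT.fderiv_restrictScalars ℝ]
    simp [mul_comm]

end Charts

/-! ### Conformal immersions in local coordinates -/

section Local

variable {M : Type*} [TopologicalSpace M] [ChartedSpace ℂ M] {f N R : M → ℍ[ℝ]}

theorem conformalOn_chart [IsManifold 𝓘(ℂ) ω M] (hf : ContMDiff 𝓘(ℝ, ℂ) 𝓘(ℝ, ℍ[ℝ]) ∞ f)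
    (hi : ∀ p, Function.Injective (diff f p)) (hN : IsLeftNormal f N) (hR : IsRightNormal f R)
    (p : M) :
    ConformalOn (chartAt ℂ p).target (f ∘ (chartAt ℂ p).symm) (N ∘ (chartAt ℂ p).symm)
      (R ∘ (chartAt ℂ p).symm) := by
  have : IsManifold 𝓘(ℝ, ℂ) ∞ M := isManifold_real
  set e := chartAt ℂ p
  have hsm : ContDiffOn ℝ ∞ (f ∘ e.symm) e.target := contDiffOn_comp_chart_symm hf p
  have hx := contDiffOn_dx e.open_target hsm
  have hy := contDiffOn_dy e.open_target hsm
  have hne : ∀ z ∈ e.target, dx (f ∘ e.symm) z ≠ 0 := by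
    intro z hz h0
    obtain ⟨c, hc, h⟩ := exists_diff_eq_fderiv_mul p hz
    have h1 := h f hf c⁻¹
    rw [mul_inv_cancel₀ hc] at h1
    have h2 : diff f (e.symm z) c⁻¹ = diff f (e.symm z) 0 := by
      rw [map_zero]; exact h1.trans h0
    exact inv_ne_zero hc (hi _ h2)
  have hl : ∀ z ∈ e.target, dy (f ∘ e.symm) z = N (e.symm z) * dx (f ∘ e.symm) z := by
    intro z hz
    obtain ⟨c, hc, h⟩ := exists_diff_eq_fderiv_mul p hz
    have h1 := hN.2 (e.symm z) c⁻¹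
    rw [starDiff, h f hf, h f hf, mul_left_comm, mul_inv_cancel₀ hc, mul_one] at h1
    exact h1
  have hr : ∀ z ∈ e.target, dy (f ∘ e.symm) z = -(dx (f ∘ e.symm) z * R (e.symm z)) := by
    intro z hz
    obtain ⟨c, hc, h⟩ := exists_diff_eq_fderiv_mul p hz
    have h1 := hR.2 (e.symm z) c⁻¹
    rw [starDiff, h f hf, h f hf, mul_left_comm, mul_inv_cancel₀ hc, mul_one] at h1
    exact h1
  have hinv := contDiffOn_inv_quaternion hx hne
  exact {
    isOpen := e.open_target
    smooth := hsm
    -- No regularity of the normals is assumed: it follows from `N = F_y F_x⁻¹` and `R = -F_x⁻¹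
    -- F_y`.
    smooth_left := (hy.mul hinv).congr fun z hz => by
      simp [hl z hz, hne z hz]
    smooth_right := (hinv.mul hy).neg.congr fun z hz => by
      simp [hr z hz, hne z hz]
    sq_left := fun z _ => hN.1 _
    sq_right := fun z _ => hR.1 _
    left := hl
    right := hr
    dx_ne := hne }

theorem contMDiff_of_charts [IsManifold 𝓘(ℂ) ω M] {g : M → ℍ[ℝ]}
    (h : ∀ p, ContDiffOn ℝ ∞ (g ∘ (chartAt ℂ p).symm) (chartAt ℂ p).target) :
    ContMDiff 𝓘(ℝ, ℂ) 𝓘(ℝ, ℍ[ℝ]) ∞ g := by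
  have : IsManifold 𝓘(ℝ, ℂ) ∞ M := isManifold_real
  intro p
  set e := chartAt ℂ p
  have hp : p ∈ e.source := mem_chart_source ℂ p
  have h1 : ContMDiffOn 𝓘(ℝ, ℂ) 𝓘(ℝ, ℍ[ℝ]) ∞ ((g ∘ e.symm) ∘ e) e.source :=
    (h p).contMDiffOn.comp (contMDiffOn_chart (n := ∞)) fun y hy => e.map_source hy
  refine (h1.contMDiffAt (e.open_source.mem_nhds hp)).congr_of_eventuallyEq ?_
  filter_upwards [e.open_source.mem_nhds hp] with y hy
  simp [e.left_inv hy]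

/-- The right normal of an immersion is unique. -/
theorem IsRightNormal.unique (hi : ∀ p, Function.Injective (diff f p)) {R' : M → ℍ[ℝ]}
    (hR : IsRightNormal f R) (hR' : IsRightNormal f R') : R = R' := by
  ext1 p
  have hne : diff f p 1 ≠ 0 := fun h => one_ne_zero (hi p (h.trans (map_zero _).symm))
  have h := (hR.2 p 1).symm.trans (hR'.2 p 1)
  exact mul_left_cancel₀ hne (neg_injective h)

instance : StarModule ℝ ℍ[ℝ] := ⟨fun r x => by ext <;> simp⟩

theorem diff_star (hf : ContMDiff 𝓘(ℝ, ℂ) 𝓘(ℝ, ℍ[ℝ]) ∞ f) (p : M) (X : ℂ) :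
    diff (fun p => star (f p)) p X = star (diff f p X) := by
  have hd := mdifferentiableAt_of_contMDiff hf p
  have h : ContDiff ℝ ∞ (fun x : ℍ[ℝ] => star x) :=
    (starL' ℝ : ℍ[ℝ] ≃L[ℝ] ℍ[ℝ]).contDiff
  have hd' : MDifferentiableAt 𝓘(ℝ, ℂ) 𝓘(ℝ, ℍ[ℝ]) (fun p => star (f p)) p :=
    ((h.contMDiff.comp hf) p).mdifferentiableAt (by simp)
  rw [diff_eq_fderiv hd, diff_eq_fderiv hd']
  have := fderiv_star (𝕜 := ℝ) (f := f ∘ (chartAt ℂ p).symm) (x := chartAt ℂ p p)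
  exact congrArg (fun L => L X) this

theorem contMDiff_star (hf : ContMDiff 𝓘(ℝ, ℂ) 𝓘(ℝ, ℍ[ℝ]) ∞ f) :
    ContMDiff 𝓘(ℝ, ℂ) 𝓘(ℝ, ℍ[ℝ]) ∞ (fun p => star (f p)) :=
  ((starL' ℝ : ℍ[ℝ] ≃L[ℝ] ℍ[ℝ]).contDiff.contMDiff).comp hf

/-- Conjugation reverses products and sends `N` to `-N`, which is the sign in the definition of a
right normal. -/
theorem IsLeftNormal.isRightNormal_star (hf : ContMDiff 𝓘(ℝ, ℂ) 𝓘(ℝ, ℍ[ℝ]) ∞ f)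
    (hN : IsLeftNormal f N) : IsRightNormal (fun p => star (f p)) N := by
  refine ⟨hN.1, fun p X => ?_⟩
  have h := hN.2 p X
  rw [starDiff] at h
  rw [starDiff, diff_star hf, diff_star hf, h, star_mul, star_of_sq_neg_one (hN.1 p), mul_neg]

theorem IsRightNormal.isLeftNormal_star (hf : ContMDiff 𝓘(ℝ, ℂ) 𝓘(ℝ, ℍ[ℝ]) ∞ f)
    (hR : IsRightNormal f R) : IsLeftNormal (fun p => star (f p)) R := by
  refine ⟨hR.1, fun p X => ?_⟩
  have h := hR.2 p X
  rw [starDiff] at h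
  rw [starDiff, diff_star hf, diff_star hf, h, star_neg, star_mul, star_of_sq_neg_one (hR.1 p),
    neg_mul, neg_neg]

theorem IsConformalImmersion.star (hf : IsConformalImmersion f) :
    IsConformalImmersion (fun p => star (f p)) where
  smooth := contMDiff_star hf.smooth
  immersion := fun p X Y h => by
    rw [diff_star hf.smooth, diff_star hf.smooth] at h
    exact hf.immersion p (star_injective h)
  conformal := by
    obtain ⟨N, R, hN, hR⟩ := hf.conformal
    exact ⟨R, N, hR.isLeftNormal_star hf.smooth, hN.isRightNormal_star hf.smooth⟩

/-- The equation `*dR = R dR` at the point `p`. -/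
def NormalHolomorphicAt (R : M → ℍ[ℝ]) (p : M) : Prop :=
  ∀ X, starDiff R p X = R p * diff R p X

/-- A change of holomorphic coordinate multiplies tangent vectors by a complex number, which
commutes with multiplication by `i`. One tangent direction then determines the equation for all of
them. -/
theorem normalHolomorphicAt_iff_defect [IsManifold 𝓘(ℂ) ω M]
    (hR : ContMDiff 𝓘(ℝ, ℂ) 𝓘(ℝ, ℍ[ℝ]) ∞ R) (hsq : ∀ p, R p * R p = -1) (p : M) {z : ℂ}
    (hz : z ∈ (chartAt ℂ p).target) :
    NormalHolomorphicAt R ((chartAt ℂ p).symm z) ↔ defect (R ∘ (chartAt ℂ p).symm) z = 0 := by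
  rw [defect_eq_zero_iff (hsq _)]
  obtain ⟨c, hc, h⟩ := exists_diff_eq_fderiv_mul p hz
  constructor
  · intro hX
    have h1 := hX c⁻¹
    rw [starDiff, h R hR, h R hR, mul_left_comm, mul_inv_cancel₀ hc, mul_one] at h1
    exact h1
  · intro h0 X
    have hRR : ∀ x, R ((chartAt ℂ p).symm z) * (R ((chartAt ℂ p).symm z) * x) = -x := fun x => by
      rw [← mul_assoc, hsq, neg_one_mul]
    rw [starDiff, h R hR, h R hR, mul_left_comm, fderiv_eq_dx_dy _ _ (Complex.I * _),
      fderiv_eq_dx_dy _ _ (c * X), h0]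
    simp only [Function.comp_apply, mul_add, mul_smul_comm, hRR]
    simp
    module

/-- At every point, the curvature ellipse is a circle if and only if one of the two normals is
holomorphic there. -/
theorem isSuperConformal_iff [IsManifold 𝓘(ℂ) ω M] (hf : ContMDiff 𝓘(ℝ, ℂ) 𝓘(ℝ, ℍ[ℝ]) ∞ f)
    (hi : ∀ p, Function.Injective (diff f p)) (hN : IsLeftNormal f N) (hR : IsRightNormal f R) :
    IsSuperConformal f ↔ ∀ p, NormalHolomorphicAt R p ∨ NormalHolomorphicAt N p := by
  have hC := conformalOn_chart hf hi hN hR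
  have hRs := contMDiff_of_charts fun p => (hC p).smooth_right
  have hNs := contMDiff_of_charts fun p => (hC p).smooth_left
  refine forall_congr' fun p => ?_
  have hz := mem_chart_target ℂ p
  have h1 := normalHolomorphicAt_iff_defect hRs hR.1 p hz
  have h2 := normalHolomorphicAt_iff_defect hNs hN.1 p hz
  rw [(chartAt ℂ p).left_inv (mem_chart_source ℂ p)] at h1 h2
  rw [h1, h2, ← (hC p).curvature_circle_iff hz]
  simp only [curvatureEllipse, secondFundamentalForm, normalSpace,
    diff_eq_fderiv (mdifferentiableAt_of_contMDiff hf p)]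

theorem rightNormalHolomorphic_iff (hi : ∀ p, Function.Injective (diff f p))
    (hR : IsRightNormal f R) : RightNormalHolomorphic f ↔ ∀ p, NormalHolomorphicAt R p := by
  constructor
  · rintro ⟨R', hR', h⟩
    rw [hR.unique hi hR']
    exact h
  · exact fun h => ⟨R, hR, h⟩

/-- On a connected surface, a pointwise alternative between the two normals is a global one. -/
theorem forall_normalHolomorphicAt_or [ConnectedSpace M] [IsManifold 𝓘(ℂ) ω M]
    (hf : ContMDiff 𝓘(ℝ, ℂ) 𝓘(ℝ, ℍ[ℝ]) ∞ f)
    (hi : ∀ p, Function.Injective (diff f p)) (hN : IsLeftNormal f N) (hR : IsRightNormal f R)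
    (h : ∀ p, NormalHolomorphicAt R p ∨ NormalHolomorphicAt N p) :
    (∀ p, NormalHolomorphicAt R p) ∨ ∀ p, NormalHolomorphicAt N p := by
  have hC := conformalOn_chart hf hi hN hR
  have hRs := contMDiff_of_charts fun p => (hC p).smooth_right
  have hNs := contMDiff_of_charts fun p => (hC p).smooth_left
  have hdR := fun p z hz => normalHolomorphicAt_iff_defect (z := z) hRs hR.1 p hz
  have hdN := fun p z hz => normalHolomorphicAt_iff_defect (z := z) hNs hN.1 p hz
  -- vanishing of the defect near a point, read in a chart
  have hnhds : ∀ p, ∀ q ∈ (chartAt ℂ p).source, (∀ᶠ y in nhds q, NormalHolomorphicAt R y) ↔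
      defect (R ∘ (chartAt ℂ p).symm) =ᶠ[nhds (chartAt ℂ p q)] 0 := by
    intro p q hq
    set e := chartAt ℂ p
    constructor
    · intro hev
      have hc : Filter.Tendsto e.symm (nhds (e q)) (nhds q) := by
        have := e.symm.continuousAt (e.map_source hq)
        rw [ContinuousAt, e.left_inv hq] at this
        exact this
      filter_upwards [hc.eventually hev, e.open_target.mem_nhds (e.map_source hq)] with z hz hzt
      exact (hdR p z hzt).1 hz
    · intro hev
      filter_upwards [(e.continuousAt hq).eventually hev, e.open_source.mem_nhds hq] with y hy hys
      have := (hdR p (e y) (e.map_source hys)).2 hy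
      rwa [e.left_inv hys] at this
  -- The interior of the holomorphic locus of `R`; unique continuation makes it closed.
  set S : Set M := {p | ∀ᶠ y in nhds p, NormalHolomorphicAt R y} with hS
  have hopen : IsOpen S := isOpen_iff_mem_nhds.2 fun p hp => Filter.Eventually.eventually_nhds hp
  have hclosed : IsClosed S := by
    refine isClosed_of_closure_subset fun p hp => ?_
    set e := chartAt ℂ p with he
    have hps : p ∈ e.source := mem_chart_source ℂ p
    obtain ⟨δ, hδ, hball⟩ := (hC p).exists_ball_unique_continuation
      (fun z hz => by rw [← hdR p z hz, ← hdN p z hz]; exact h _) (e.map_source hps)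
    have hU : e.source ∩ e ⁻¹' ball (e p) δ ∈ nhds p :=
      Filter.inter_mem (e.open_source.mem_nhds hps)
        ((e.continuousAt hps).preimage_mem_nhds (ball_mem_nhds _ hδ))
    obtain ⟨q, ⟨hqs, hqb⟩, hqS⟩ := mem_closure_iff_nhds.1 hp _ hU
    exact (hnhds p p hps).2 (hball (e q) hqb ((hnhds p q hqs).1 hqS))
  rcases isClopen_iff.1 ⟨hclosed, hopen⟩ with h0 | h1
  -- If the defect of `N` were non-zero at a point, it would be so nearby. The defect of `R` would
  -- then vanish there, and the point would lie in the empty set `S`.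
  · right
    intro p
    set e := chartAt ℂ p with he
    have hps : p ∈ e.source := mem_chart_source ℂ p
    have hpt := e.map_source hps
    have hcont := (contDiffOn_defect e.open_target (hC p).smooth_left).continuousOn.continuousAt
      (e.open_target.mem_nhds hpt)
    have hp := (hdN p (e p) hpt)
    rw [e.left_inv hps] at hp
    rw [hp]
    by_contra hne
    have hev := hcont.eventually_ne hne
    have hpS : p ∈ S := by
      refine (hnhds p p hps).2 ?_
      filter_upwards [hev, e.open_target.mem_nhds hpt] with z hz hzt
      have := (h (e.symm z)).resolve_right fun hN' => hz ((hdN p z hzt).1 hN')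
      exact (hdR p z hzt).1 this
    rw [h0] at hpS
    exact hpS
  · left
    intro p
    have hpS : p ∈ S := h1 ▸ Set.mem_univ p
    exact Filter.Eventually.self_of_nhds hpS

/-- Super-conformality is equivalent to the holomorphicity of one of the two normals. -/
theorem isSuperConformal_iff_rightNormalHolomorphic [ConnectedSpace M] [IsManifold 𝓘(ℂ) ω M]
    (hf : IsConformalImmersion f) : IsSuperConformal f ↔
      (RightNormalHolomorphic f ∨ RightNormalHolomorphic (fun p => star (f p))) := by
  obtain ⟨N, R, hN, hR⟩ := hf.conformal
  rw [isSuperConformal_iff hf.smooth hf.immersion hN hR,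
    rightNormalHolomorphic_iff hf.immersion hR,
    rightNormalHolomorphic_iff hf.star.immersion (hN.isRightNormal_star hf.smooth)]
  constructor
  · exact forall_normalHolomorphicAt_or hf.smooth hf.immersion hN hR
  · rintro (h | h) p
    · exact Or.inl (h p)
    · exact Or.inr (h p)

end Local

/-! ### Differentials of composite functions -/

section Differential

variable {M : Type*} [TopologicalSpace M] [ChartedSpace ℂ M]
  {F G : Type*} [NormedAddCommGroup F] [NormedSpace ℝ F] [NormedAddCommGroup G] [NormedSpace ℝ G]

theorem differentiableAt_comp_chart_symm {g : M → F} {p : M}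
    (hg : MDifferentiableAt 𝓘(ℝ, ℂ) 𝓘(ℝ, F) g p) :
    DifferentiableAt ℝ (g ∘ (chartAt ℂ p).symm) (chartAt ℂ p p) := by
  have h := hg.differentiableWithinAt_writtenInExtChartAt
  simp only [writtenInExtChartAt, extChartAt, mfld_simps, differentiableWithinAt_univ] at h
  exact h

theorem diff_clm_comp {g : M → F} {p : M} (hg : MDifferentiableAt 𝓘(ℝ, ℂ) 𝓘(ℝ, F) g p)
    (L : F →L[ℝ] G) (X : ℂ) : diff (fun q => L (g q)) p X = L (diff g p X) := by
  have hL : MDifferentiableAt 𝓘(ℝ, ℂ) 𝓘(ℝ, G) (fun q => L (g q)) p :=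
    L.differentiableAt.mdifferentiableAt.comp p hg
  rw [diff_eq_fderiv hg, diff_eq_fderiv hL]
  have h := (L.hasFDerivAt (x := (g ∘ (chartAt ℂ p).symm) (chartAt ℂ p p))).comp _
    (differentiableAt_comp_chart_symm hg).hasFDerivAt
  exact congrArg (fun T => T X) h.fderiv

theorem diff_mul {g h : M → ℍ[ℝ]} {p : M} (hg : MDifferentiableAt 𝓘(ℝ, ℂ) 𝓘(ℝ, ℍ[ℝ]) g p)
    (hh : MDifferentiableAt 𝓘(ℝ, ℂ) 𝓘(ℝ, ℍ[ℝ]) h p) (X : ℂ) :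
    diff (fun q => g q * h q) p X = g p * diff h p X + diff g p X * h p := by
  have hgh : MDifferentiableAt 𝓘(ℝ, ℂ) 𝓘(ℝ, ℍ[ℝ]) (fun q => g q * h q) p := hg.mul hh
  rw [diff_eq_fderiv hg, diff_eq_fderiv hh, diff_eq_fderiv hgh]
  have := fderiv_mul' (𝕜 := ℝ) (differentiableAt_comp_chart_symm hg)
    (differentiableAt_comp_chart_symm hh)
  refine (congrArg (fun T => T X) this).trans ?_
  simp [(chartAt ℂ p).left_inv (mem_chart_source ℂ p)]

theorem contMDiff_mul_quaternion {g h : M → ℍ[ℝ]} (hg : ContMDiff 𝓘(ℝ, ℂ) 𝓘(ℝ, ℍ[ℝ]) ∞ g)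
    (hh : ContMDiff 𝓘(ℝ, ℂ) 𝓘(ℝ, ℍ[ℝ]) ∞ h) :
    ContMDiff 𝓘(ℝ, ℂ) 𝓘(ℝ, ℍ[ℝ]) ∞ (fun q => g q * h q) := by
  have hm : ContDiff ℝ ∞ fun x : ℍ[ℝ] × ℍ[ℝ] => x.1 * x.2 := contDiff_fst.mul contDiff_snd
  exact hm.contMDiff.comp (hg.prodMk_space hh)

theorem diff_congr {g h : M → F} {p : M} (e : g =ᶠ[nhds p] h) : diff g p = diff h p :=
  e.mfderiv_eq

theorem diff_const (c : F) (p : M) : diff (fun _ : M => c) p = 0 := mfderiv_const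

end Differential

/-! ### The identification of `ℂ⁴` with `ℍ²` -/

section Identification

/-- The inverse of `toH2`. -/
def ofH2 (x : ℍ[ℝ] × ℍ[ℝ]) : Fin 4 → ℂ :=
  -- The minus signs come from `j i = -k`.
  ![⟨x.1.re, x.1.imI⟩, ⟨x.1.imJ, -x.1.imK⟩, ⟨x.2.re, x.2.imI⟩, ⟨x.2.imJ, -x.2.imK⟩]

theorem quatJ_re : quatJ.re = 0 := rfl

theorem quatJ_imI : quatJ.imI = 0 := rfl

theorem quatJ_imJ : quatJ.imJ = 1 := rfl

theorem quatJ_imK : quatJ.imK = 0 := rfl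

theorem toH2_ofH2 (x : ℍ[ℝ] × ℍ[ℝ]) : toH2 (ofH2 x) = x := by
  refine Prod.ext ?_ ?_ <;> ext <;> simp [toH2, ofH2, quatJ_re, quatJ_imI, quatJ_imJ, quatJ_imK]

theorem ofH2_toH2 (z : Fin 4 → ℂ) : ofH2 (toH2 z) = z := by
  ext i
  fin_cases i <;> apply Complex.ext <;> simp [toH2, ofH2, quatJ_re, quatJ_imI, quatJ_imJ, quatJ_imK]

/-- `toH2` as a real linear equivalence. -/
def toH2Linear : (Fin 4 → ℂ) ≃ₗ[ℝ] ℍ[ℝ] × ℍ[ℝ] where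
  toFun := toH2
  map_add' z w := by
    simp only [toH2, Pi.add_apply, Quaternion.coeComplex_add, mul_add, Prod.mk_add_mk]
    refine Prod.ext ?_ ?_ <;> simp only <;> abel
  map_smul' r z := by
    refine Prod.ext ?_ ?_ <;> ext <;> simp [toH2, quatJ_re, quatJ_imI, quatJ_imJ, quatJ_imK]
  invFun := ofH2
  left_inv := ofH2_toH2
  right_inv := toH2_ofH2

/-- `toH2` as a continuous real linear equivalence. -/
def toH2L : (Fin 4 → ℂ) ≃L[ℝ] ℍ[ℝ] × ℍ[ℝ] := toH2Linear.toContinuousLinearEquiv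

theorem toH2_sub (z w : Fin 4 → ℂ) : toH2 (z - w) = toH2 z - toH2 w := map_sub toH2L z w

theorem toH2_injective : Function.Injective toH2 := toH2L.injective

theorem toH2_smul_fst (c : ℂ) (z : Fin 4 → ℂ) : (toH2 (c • z)).1 = (toH2 z).1 * (c : ℍ[ℝ]) := by
  rw [toH2_smul]; rfl

theorem toH2_smul_snd (c : ℂ) (z : Fin 4 → ℂ) : (toH2 (c • z)).2 = (toH2 z).2 * (c : ℍ[ℝ]) := by
  rw [toH2_smul]; rfl

/-- The quaternion `i`. -/
def quatI : ℍ[ℝ] := ((Complex.I : ℂ) : ℍ[ℝ])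

theorem quatI_mul_quatI : quatI * quatI = -1 := by
  rw [quatI, ← Quaternion.coeComplex_mul, Complex.I_mul_I]
  ext <;> simp

theorem coeComplex_mul_quatI (c : ℂ) : (c : ℍ[ℝ]) * quatI = quatI * (c : ℍ[ℝ]) := by
  rw [quatI, ← Quaternion.coeComplex_mul, ← Quaternion.coeComplex_mul, mul_comm]

theorem exists_coeComplex_of_commute {s : ℍ[ℝ]} (h : s * quatI = quatI * s) :
    ∃ c : ℂ, s = (c : ℍ[ℝ]) := by
  obtain ⟨α, β, h⟩ := exists_eq_add_smul_of_commute quatI_mul_quatI h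
  refine ⟨⟨α, β⟩, ?_⟩
  rw [h]
  ext <;> simp [quatI]

/-- Every square root of `-1` is conjugate to `-i`. -/
theorem exists_mul_eq_neg_mul_quatI {K : ℍ[ℝ]} (hK : K * K = -1) :
    ∃ l : ℍ[ℝ], l ≠ 0 ∧ K * l = -(l * quatI) := by
  -- The solution is `1 + K i`. It degenerates only for `K = i`, where `j` serves instead.
  by_cases h : 1 + K * quatI = 0
  · have hKi : K = quatI := by
      have h1 := congrArg (· * quatI) h
      simp only [add_mul, one_mul, mul_assoc, quatI_mul_quatI, zero_mul, mul_neg, mul_one] at h1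
      rw [← sub_eq_add_neg, sub_eq_zero] at h1
      exact h1.symm
    refine ⟨quatJ, fun h0 => ?_, ?_⟩
    · have := congrArg QuaternionAlgebra.imJ h0
      simp [quatJ_imJ] at this
    · rw [hKi]
      ext <;> simp [quatI, quatJ_re, quatJ_imI, quatJ_imJ, quatJ_imK]
  · refine ⟨1 + K * quatI, h, ?_⟩
    rw [mul_add, add_mul, ← mul_assoc, hK, mul_assoc, quatI_mul_quatI]
    simp

end Identification

/-! ### The twistor lift -/

section TwistorLift

/-- The derivative `λ'` of a solution of `R λ = -λ i` satisfies `R a = -a i` for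
`a = *λ' - λ' i` if and only if `*R' = R R'`. -/
theorem normal_equation_iff {R l dR dR' dl dl' : ℍ[ℝ]} (hl0 : l ≠ 0)
    (hl : R * l = -(l * quatI)) (hdR : dR * R = -(R * dR))
    (hdl : R * dl + dR * l = -(dl * quatI)) (hdl' : R * dl' + dR' * l = -(dl' * quatI)) :
    R * (dl' - dl * quatI) = -((dl' - dl * quatI) * quatI) ↔ dR' = R * dR := by
  have e1 : dR' * l = -(dl' * quatI) - R * dl' := by rw [← hdl']; abel
  have e2 : R * dR * l = dl - R * (dl * quatI) := by
    have h1 : dR * l = -(dl * quatI) - R * dl := by rw [← hdl]; abel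
    have h2 : R * dR * l = dR * l * quatI := by
      rw [← neg_inj, ← neg_mul, ← hdR, mul_assoc, hl, mul_neg, mul_assoc]
    rw [h2, h1, sub_mul, neg_mul, mul_assoc, quatI_mul_quatI, mul_assoc]
    simp
  have e3 : (dR' - R * dR) * l
      = -(R * (dl' - dl * quatI) + (dl' - dl * quatI) * quatI) := by
    rw [sub_mul, e1, e2, mul_sub, sub_mul, mul_assoc dl, quatI_mul_quatI]
    simp only [mul_neg, mul_one]
    abel
  rw [← sub_eq_zero (a := dR'), eq_neg_iff_add_eq_zero]
  constructor
  · intro h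
    rw [h, neg_zero] at e3
    exact (mul_eq_zero.1 e3).resolve_right hl0
  · intro h
    rw [h, zero_mul, eq_comm, neg_eq_zero] at e3
    exact e3

variable {M : Type*} [TopologicalSpace M] [ChartedSpace ℂ M] {f R : M → ℍ[ℝ]}

theorem diff_mul_self_of_sq {R : M → ℍ[ℝ]} {p : M}
    (hR : MDifferentiableAt 𝓘(ℝ, ℂ) 𝓘(ℝ, ℍ[ℝ]) R p) (hsq : ∀ p, R p * R p = -1) (X : ℂ) :
    diff R p X * R p = -(R p * diff R p X) := by
  have h := diff_mul hR hR X
  simp only [hsq] at h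
  rw [diff_const, add_comm] at h
  exact eq_neg_of_add_eq_zero_left h.symm

/-- A line of `ℍ²` in the affine chart. -/
theorem mem_affinePoint_submodule {x : ℍ[ℝ]} {v : ℍ[ℝ] × ℍ[ℝ]} :
    v ∈ (affinePoint x).submodule ↔ v.1 = x * v.2 := by
  rw [affinePoint, Projectivization.submodule_mk, Submodule.mem_span_singleton]
  constructor
  · rintro ⟨a, rfl⟩
    simp [MulOpposite.smul_eq_mul_unop]
  · intro h
    refine ⟨MulOpposite.op v.2, Prod.ext ?_ ?_⟩ <;> simp [h]

/-- The data of a local section of a line bundle that projects to `[f; 1]`. -/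
theorem section_derivative {φ : M → Fin 4 → ℂ} {U : Set M} {p : M} (hU : IsOpen U) (hp : p ∈ U)
    (hf : MDifferentiableAt 𝓘(ℝ, ℂ) 𝓘(ℝ, ℍ[ℝ]) f p)
    (hφ : ContMDiffOn 𝓘(ℝ, ℂ) 𝓘(ℝ, Fin 4 → ℂ) ∞ φ U)
    (hφf : ∀ q ∈ U, (toH2 (φ q)).1 = f q * (toH2 (φ q)).2) :
    MDifferentiableAt 𝓘(ℝ, ℂ) 𝓘(ℝ, Fin 4 → ℂ) φ p ∧
    MDifferentiableAt 𝓘(ℝ, ℂ) 𝓘(ℝ, ℍ[ℝ]) (fun q => (toH2 (φ q)).2) p ∧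
    ∀ X, (toH2 (diff φ p X)).2 = diff (fun q => (toH2 (φ q)).2) p X ∧
      (toH2 (diff φ p X)).1 = f p * diff (fun q => (toH2 (φ q)).2) p X
        + diff f p X * (toH2 (φ p)).2 := by
  have hd : MDifferentiableAt 𝓘(ℝ, ℂ) 𝓘(ℝ, Fin 4 → ℂ) φ p :=
    (hφ.contMDiffAt (hU.mem_nhds hp)).mdifferentiableAt (by simp)
  let L₁ : (Fin 4 → ℂ) →L[ℝ] ℍ[ℝ] :=
    (ContinuousLinearMap.fst ℝ ℍ[ℝ] ℍ[ℝ]).comp toH2L.toContinuousLinearMap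
  let L₂ : (Fin 4 → ℂ) →L[ℝ] ℍ[ℝ] :=
    (ContinuousLinearMap.snd ℝ ℍ[ℝ] ℍ[ℝ]).comp toH2L.toContinuousLinearMap
  have hd₂ : MDifferentiableAt 𝓘(ℝ, ℂ) 𝓘(ℝ, ℍ[ℝ]) (fun q => (toH2 (φ q)).2) p :=
    (L₂.differentiableAt (x := φ p)).mdifferentiableAt.comp p hd
  refine ⟨hd, hd₂, fun X => ⟨(diff_clm_comp hd L₂ X).symm, ?_⟩⟩
  have h1 : (toH2 (diff φ p X)).1 = diff (fun q => (toH2 (φ q)).1) p X :=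
    (diff_clm_comp hd L₁ X).symm
  have h2 : (fun q => (toH2 (φ q)).1) =ᶠ[nhds p] fun q => f q * (toH2 (φ q)).2 := by
    filter_upwards [hU.mem_nhds hp] with q hq using hφf q hq
  rw [h1, diff_congr h2, diff_mul hf hd₂]

theorem diff_I_smul {φ : M → Fin 4 → ℂ} {p : M}
    (hd : MDifferentiableAt 𝓘(ℝ, ℂ) 𝓘(ℝ, Fin 4 → ℂ) φ p) (X : ℂ) :
    diff (fun q => Complex.I • φ q) p X = Complex.I • diff φ p X :=
  diff_clm_comp hd ((Complex.I • ContinuousLinearMap.id ℂ (Fin 4 → ℂ)).restrictScalars ℝ) X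

theorem delta_eq_iff {E : M → CP3} {φ : M → Fin 4 → ℂ} {p : M}
    (hd : MDifferentiableAt 𝓘(ℝ, ℂ) 𝓘(ℝ, Fin 4 → ℂ) φ p) (X : ℂ) :
    delta E φ p (Complex.I * X) = delta E (fun q => Complex.I • φ q) p X ↔
      diff φ p (Complex.I * X) - Complex.I • diff φ p X ∈ (E p).submodule := by
  rw [delta, delta, diff_I_smul hd, Submodule.mkQ_apply, Submodule.mkQ_apply,
    Submodule.Quotient.eq]

theorem diff_normal_equation {l : M → ℍ[ℝ]} {U : Set M} {p : M} (hU : IsOpen U) (hp : p ∈ U)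
    (hR : MDifferentiableAt 𝓘(ℝ, ℂ) 𝓘(ℝ, ℍ[ℝ]) R p)
    (hl : MDifferentiableAt 𝓘(ℝ, ℂ) 𝓘(ℝ, ℍ[ℝ]) l p)
    (h : ∀ q ∈ U, R q * l q = -(l q * quatI)) (X : ℂ) :
    R p * diff l p X + diff R p X * l p = -(diff l p X * quatI) := by
  have e : (fun q => R q * l q) =ᶠ[nhds p] fun q => l q * -quatI := by
    filter_upwards [hU.mem_nhds hp] with q hq
    rw [h q hq, mul_neg]
  have h1 : diff (fun q => R q * l q) p X = diff (fun q => l q * -quatI) p X := by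
    rw [diff_congr e]
  rw [diff_mul hR hl, diff_mul hl (mdifferentiableAt_const (c := -quatI)), diff_const] at h1
  rw [h1]
  simp

theorem rightNormalHolomorphic_of_twistor [IsManifold 𝓘(ℂ) ω M]
    (hf : ContMDiff 𝓘(ℝ, ℂ) 𝓘(ℝ, ℍ[ℝ]) ∞ f) (hi : ∀ p, Function.Injective (diff f p))
    (hRs : ContMDiff 𝓘(ℝ, ℂ) 𝓘(ℝ, ℍ[ℝ]) ∞ R) (hR : IsRightNormal f R)
    (h : IsTwistorHolomorphic (fun p => affinePoint (f p))) : RightNormalHolomorphic f := by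
  obtain ⟨E, ⟨hE, hol⟩, hproj⟩ := h
  refine ⟨R, hR, fun p X => ?_⟩
  obtain ⟨U, hU, hpU, φ, hφ, hφ0⟩ := hE p
  have hmem : ∀ q, ∀ v ∈ (E q).submodule, (toH2 v).1 = f q * (toH2 v).2 := by
    intro q v hv
    rw [← mem_affinePoint_submodule, hproj q]
    exact Submodule.subset_span ⟨v, hv, rfl⟩
  have hφf : ∀ q ∈ U, (toH2 (φ q)).1 = f q * (toH2 (φ q)).2 := fun q hq =>
    hmem q _ (hφ.2 q hq)
  set l : M → ℍ[ℝ] := fun q => (toH2 (φ q)).2 with hl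
  have hl0 : ∀ q ∈ U, l q ≠ 0 := by
    intro q hq h0
    apply hφ0 q hq
    apply toH2_injective
    have h1 := hφf q hq
    rw [show (toH2 (φ q)).2 = 0 from h0, mul_zero] at h1
    rw [show toH2 0 = 0 from map_zero toH2L]
    exact Prod.ext h1 h0
  have hder := fun q hq =>
    section_derivative hU hq (mdifferentiableAt_of_contMDiff hf q) hφ.1 hφf
  -- The holomorphicity condition says that this difference lies in the fibre, which the
  -- non-vanishing section `φ` spans over `ℂ`.
  have hline : ∀ q ∈ U, ∀ X, ∃ c : ℂ,
      diff φ q (Complex.I * X) - Complex.I • diff φ q X = c • φ q := by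
    intro q hq X
    have h1 := (delta_eq_iff (E := E) (hder q hq).1 X).1 (hol U φ hU hφ q hq X)
    have hspan : (E q).submodule = Submodule.span ℂ {φ q} := by
      have h2 : Submodule.span ℂ {φ q} ≤ (E q).submodule := by
        rw [Submodule.span_singleton_le_iff_mem]; exact hφ.2 q hq
      have : Module.Finite ℂ (E q).submodule := inferInstance
      exact (Submodule.eq_of_le_of_finrank_eq h2 (by
        rw [(E q).finrank_submodule, finrank_span_singleton (hφ0 q hq)])).symm
    rw [hspan, Submodule.mem_span_singleton] at h1
    obtain ⟨c, hc⟩ := h1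
    exact ⟨c, hc.symm⟩
  have hsnd : ∀ q ∈ U, ∀ X, ∃ c : ℂ,
      diff l q (Complex.I * X) - diff l q X * quatI = l q * (c : ℍ[ℝ]) ∧
      diff f q (Complex.I * X) * l q = diff f q X * l q * quatI := by
    intro q hq X
    obtain ⟨c, hc⟩ := hline q hq X
    have e2 := congrArg (fun v => (toH2 v).2) hc
    have e1 := congrArg (fun v => (toH2 v).1) hc
    simp only [toH2_sub, Prod.snd_sub, Prod.fst_sub, toH2_smul_snd, toH2_smul_fst,
      ((hder q hq).2.2 _).1, ((hder q hq).2.2 _).2, hφf q hq] at e1 e2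
    refine ⟨c, e2, ?_⟩
    have e3 := congrArg (fun x => f q * x) e2
    simp only [mul_sub] at e3
    rw [mul_assoc (f q) (toH2 (φ q)).2, ← e3] at e1
    rw [← sub_eq_zero] at e1 ⊢
    rw [← e1]
    simp only [add_mul, mul_assoc, hl, quatI]
    abel
  -- Substituting `*df = -df R` into the first component and cancelling `df` forces the fibre to be
  -- the eigenline of `R`.
  have hnormal : ∀ q ∈ U, R q * l q = -(l q * quatI) := by
    intro q hq
    obtain ⟨c, -, h2⟩ := hsnd q hq 1
    have hne : diff f q 1 ≠ 0 := fun h => one_ne_zero (hi q (h.trans (map_zero _).symm))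
    have h3 := hR.2 q 1
    rw [starDiff] at h3
    rw [h3] at h2
    apply mul_left_cancel₀ hne
    rw [mul_neg, ← mul_assoc, ← mul_assoc, ← h2, neg_mul, neg_neg]
  obtain ⟨c, hc, -⟩ := hsnd p hpU X
  have hRd := mdifferentiableAt_of_contMDiff hRs p
  have hld := (hder p hpU).2.1
  -- The second component is `l c` with `c` complex. Since `c` commutes with `i`, it satisfies the
  -- same eigenvalue equation as `l`.
  refine (normal_equation_iff (hl0 p hpU) (hnormal p hpU)
    (diff_mul_self_of_sq hRd hR.1 X) (diff_normal_equation hU hpU hRd hld hnormal X)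
    (diff_normal_equation hU hpU hRd hld hnormal (Complex.I * X))).1 ?_
  rw [hc, ← mul_assoc, hnormal p hpU, neg_mul, mul_assoc, mul_assoc, coeComplex_mul_quatI]

theorem twistor_of_rightNormalHolomorphic [IsManifold 𝓘(ℂ) ω M]
    (hf : ContMDiff 𝓘(ℝ, ℂ) 𝓘(ℝ, ℍ[ℝ]) ∞ f)
    (hRs : ContMDiff 𝓘(ℝ, ℂ) 𝓘(ℝ, ℍ[ℝ]) ∞ R) (hR : IsRightNormal f R)
    (hol : ∀ p X, starDiff R p X = R p * diff R p X) :
    IsTwistorHolomorphic (fun p => affinePoint (f p)) := by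
  choose l₀ hl₀ hl₀R using fun p => exists_mul_eq_neg_mul_quatI (hR.1 p)
  have hv0 : ∀ p, ofH2 (f p * l₀ p, l₀ p) ≠ 0 := by
    intro p h0
    have h1 := congrArg toH2 h0
    rw [toH2_ofH2, show toH2 0 = 0 from map_zero toH2L] at h1
    exact hl₀ p (congrArg Prod.snd h1)
  let E : M → CP3 := fun p => Projectivization.mk ℂ _ (hv0 p)
  have hmem : ∀ p v, v ∈ (E p).submodule ↔
      (toH2 v).1 = f p * (toH2 v).2 ∧ R p * (toH2 v).2 = -((toH2 v).2 * quatI) := by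
    intro p v
    change v ∈ (Projectivization.mk ℂ _ (hv0 p)).submodule ↔ _
    rw [Projectivization.submodule_mk, Submodule.mem_span_singleton]
    constructor
    · rintro ⟨c, rfl⟩
      rw [toH2_smul_fst, toH2_smul_snd, toH2_ofH2]
      refine ⟨mul_assoc _ _ _, ?_⟩
      rw [← mul_assoc, hl₀R, neg_mul, mul_assoc, mul_assoc, coeComplex_mul_quatI]
    · rintro ⟨h1, h2⟩
      have hinv : (l₀ p)⁻¹ * R p = -(quatI * (l₀ p)⁻¹) := by
        have := congrArg (fun x => (l₀ p)⁻¹ * x * (l₀ p)⁻¹) (hl₀R p)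
        simpa [mul_assoc, hl₀ p] using this
      have hcomm : (l₀ p)⁻¹ * (toH2 v).2 * quatI = quatI * ((l₀ p)⁻¹ * (toH2 v).2) := by
        rw [mul_assoc, ← neg_neg ((toH2 v).2 * quatI), ← h2, mul_neg, ← mul_assoc, hinv]
        simp [mul_assoc]
      obtain ⟨c, hc⟩ := exists_coeComplex_of_commute hcomm
      have h3 : (toH2 v).2 = l₀ p * (c : ℍ[ℝ]) := by
        rw [← hc, mul_inv_cancel_left₀ (hl₀ p)]
      refine ⟨c, toH2_injective (Prod.ext ?_ ?_)⟩
      · rw [toH2_smul_fst, toH2_ofH2, h1, h3, mul_assoc]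
      · rw [toH2_smul_snd, toH2_ofH2, h3]
  refine ⟨E, ⟨?_, ?_⟩, ?_⟩
  · intro p
    -- The pointwise choice `l₀` need not be smooth, so the frame near `p` is obtained from the
    -- single vector `l₀ p`. The factor intertwines `R q` with `R p`, since both products equal `R q
    -- + R p`, and at `q = p` it is `2`.
    set l : M → ℍ[ℝ] := fun q => (1 - R q * R p) * l₀ p with hl
    have hls : ContMDiff 𝓘(ℝ, ℂ) 𝓘(ℝ, ℍ[ℝ]) ∞ l :=
      contMDiff_mul_quaternion
        (contMDiff_const.sub (contMDiff_mul_quaternion hRs contMDiff_const)) contMDiff_const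
    have hlR : ∀ q, R q * l q = -(l q * quatI) := by
      intro q
      have h1 : R q * l q = (R q + R p) * l₀ p := by
        rw [hl, ← mul_assoc, mul_sub, ← mul_assoc, hR.1]; simp
      have h2 : l q * quatI = -((R q + R p) * l₀ p) := by
        rw [hl, mul_assoc, ← neg_neg (l₀ p * quatI), ← hl₀R, mul_neg, ← mul_assoc, sub_mul,
          mul_assoc (R q), hR.1]
        simp [add_comm]
      rw [h1, h2, neg_neg]
    refine ⟨{q | l q ≠ 0}, isOpen_ne_fun hls.continuous continuous_const, ?_,
      fun q => ofH2 (f q * l q, l q), ⟨?_, ?_⟩, ?_⟩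
    · change (1 - R p * R p) * l₀ p ≠ 0
      rw [hR.1, sub_neg_eq_add, one_add_one_eq_two]
      exact mul_ne_zero (norm_ne_zero_iff.1 (by rw [norm_two_quaternion]; norm_num)) (hl₀ p)
    · have : ContMDiff 𝓘(ℝ, ℂ) 𝓘(ℝ, Fin 4 → ℂ) ∞ (fun q => toH2L.symm (f q * l q, l q)) :=
        toH2L.symm.contDiff.contMDiff.comp ((contMDiff_mul_quaternion hf hls).prodMk_space hls)
      exact this.contMDiffOn
    · intro q _
      rw [hmem, toH2_ofH2]
      exact ⟨rfl, hlR q⟩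
    · intro q hq h0
      have h1 := congrArg toH2 h0
      rw [toH2_ofH2, show toH2 0 = 0 from map_zero toH2L] at h1
      exact hq (congrArg Prod.snd h1)
  · intro U φ hU hφ p hp X
    have hφ' := fun q hq => (hmem q _).1 (hφ.2 q hq)
    obtain ⟨hd, hd₂, hder⟩ := section_derivative hU hp (mdifferentiableAt_of_contMDiff hf p) hφ.1
      fun q hq => (hφ' q hq).1
    set l : M → ℍ[ℝ] := fun q => (toH2 (φ q)).2 with hl
    rw [delta_eq_iff hd, hmem]
    have hRd := mdifferentiableAt_of_contMDiff hRs p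
    have e2 : (toH2 (diff φ p (Complex.I * X) - Complex.I • diff φ p X)).2
        = diff l p (Complex.I * X) - diff l p X * quatI := by
      rw [toH2_sub, Prod.snd_sub, toH2_smul_snd, (hder _).1, (hder _).1]; rfl
    have e1 : (toH2 (diff φ p (Complex.I * X) - Complex.I • diff φ p X)).1
        = f p * (diff l p (Complex.I * X) - diff l p X * quatI) := by
      have h3 := hR.2 p X
      rw [starDiff] at h3
      have h4 : (R p) * (toH2 (φ p)).2 = -((toH2 (φ p)).2 * quatI) := (hφ' p hp).2
      rw [toH2_sub, Prod.fst_sub, toH2_smul_fst, (hder _).2, (hder _).2, h3, neg_mul,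
        mul_assoc (diff f p X), h4]
      change _ - _ * quatI = _
      simp only [add_mul, mul_sub, mul_neg, neg_neg, mul_assoc]
      abel
    rw [e1, e2]
    refine ⟨rfl, ?_⟩
    by_cases hl0 : l p = 0
    · -- at a zero of the section, differentiate the equation directly
      have n1 := diff_normal_equation hU hp hRd hd₂ (fun q hq => (hφ' q hq).2) X
      have n2 := diff_normal_equation hU hp hRd hd₂ (fun q hq => (hφ' q hq).2) (Complex.I * X)
      rw [hl0, mul_zero, add_zero] at n1 n2
      rw [mul_sub, n2, ← mul_assoc, n1]
      noncomm_ring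
    · exact (normal_equation_iff hl0 (hφ' p hp).2 (diff_mul_self_of_sq hRd hR.1 X)
        (diff_normal_equation hU hp hRd hd₂ (fun q hq => (hφ' q hq).2) X)
        (diff_normal_equation hU hp hRd hd₂ (fun q hq => (hφ' q hq).2) (Complex.I * X))).2 (hol p X)
  · intro p
    apply le_antisymm
    · change (Projectivization.mk _ _ _).submodule ≤ _
      rw [Projectivization.submodule_mk, Submodule.span_singleton_le_iff_mem]
      have h1 : (f p * l₀ p, l₀ p) ∈ Submodule.span (ℍ[ℝ])ᵐᵒᵖ
          (toH2 '' ((E p).submodule : Set (Fin 4 → ℂ))) := by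
        refine Submodule.subset_span ⟨ofH2 (f p * l₀ p, l₀ p), ?_, toH2_ofH2 _⟩
        exact Submodule.mem_span_singleton_self _
      have h2 := Submodule.smul_mem _ (MulOpposite.op (l₀ p)⁻¹) h1
      have h3 : MulOpposite.op (l₀ p)⁻¹ • (f p * l₀ p, l₀ p) = (f p, 1) := by
        refine Prod.ext ?_ ?_ <;> simp [hl₀ p]
      rwa [h3] at h2
    · rw [Submodule.span_le]
      rintro _ ⟨v, hv, rfl⟩
      exact mem_affinePoint_submodule.2 ((hmem p v).1 hv).1

/-- A conformal immersion is a twistor projection of a holomorphic curve if and only if its right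
normal is holomorphic. -/
theorem isTwistorHolomorphic_iff [IsManifold 𝓘(ℂ) ω M] (hf : IsConformalImmersion f) :
    IsTwistorHolomorphic (fun p => affinePoint (f p)) ↔ RightNormalHolomorphic f := by
  obtain ⟨N, R, hN, hR⟩ := hf.conformal
  have hRs := contMDiff_of_charts fun p =>
    (conformalOn_chart hf.smooth hf.immersion hN hR p).smooth_right
  refine ⟨rightNormalHolomorphic_of_twistor hf.smooth hf.immersion hRs hR, fun h => ?_⟩
  exact twistor_of_rightNormalHolomorphic hf.smooth hRs hR
    ((rightNormalHolomorphic_iff hf.immersion hR).1 h)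

end TwistorLift

end

end SuperConformal

theorem mainTheorem4 {M : Type*} [TopologicalSpace M] [T2Space M] [ConnectedSpace M]
    [ChartedSpace ℂ M] [IsManifold 𝓘(ℂ) ω M]
    (f : M → ℍ[ℝ]) (hf : SuperConformal.IsConformalImmersion f) :
    (SuperConformal.IsSuperConformal f ↔
      (SuperConformal.IsTwistorHolomorphic (fun p => SuperConformal.affinePoint (f p)) ∨
        SuperConformal.IsTwistorHolomorphic (fun p => SuperConformal.affinePoint (star (f p))))) ∧
    (SuperConformal.IsSuperConformal f ↔
      (SuperConformal.RightNormalHolomorphic f ∨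
        SuperConformal.RightNormalHolomorphic (fun p => star (f p)))) := by
  have h := SuperConformal.isSuperConformal_iff_rightNormalHolomorphic hf
  refine ⟨?_, h⟩
  rw [h, SuperConformal.isTwistorHolomorphic_iff hf,
    SuperConformal.isTwistorHolomorphic_iff hf.star]
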